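/- Let $K$ be a field and let $S=K[x_1,\dots,x_n,y_1,\dots,y_m]$ be the polynomial ring with the standard bigrading $\deg(x_i)=(1,0)$, $\deg(y_j)=(0,1)$. Let $J\subsetneq S$ be a bigraded ideal and $R=S/J$. Define $$\operatorname{reg}_x(R)=\sup\{a\in\mathbb Z : \operatorname{Tor}_i^S(K,R)_{(a+i,b)}\neq 0 \text{ for some } i,b\},\qquad \operatorname{reg}_y(R)=\sup\{b\in\mathbb Z : \operatorname{Tor}_i^S(K,R)_{(a,b+i)}\neq 0 \text{ for some } i,a\}.$$ For a bigraded module $M$ write $M_{(a,*)}=\bigoplus_b M_{(a,b)}$ and $M_{(*,b)}=\bigoplus_a M_{(a,b)}$. A sequence $\xi_1,\dots,\xi_t\in R_{(1,0)}$ is called almost regular for $R$ with respect to the $x$-degree if for every $i$ $$(0:_{R/(\xi_1,\dots,\xi_{i-1})R}\,\xi_i)_{(a,*)}=0\quad\text{for } a\gg 0,$$ and a sequence $\eta_1,\dots,\eta_t\in R_{(0,1)}$ is called almost regular for $R$ with respect to the $y$-degree if for every $i$ $$(0:_{R/(\eta_1,\dots,\eta_{i-1})R}\,\eta_i)_{(*,b)}=0\quad\text{for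 } b\gg 0.$$ Let $\xi_1,\dots,\xi_n\in R_{(1,0)}$ be almost regular for $R$ with respect to the $x$-degree (for instance the residue classes of $x_1,\dots,x_n$, when these are almost regular), and let $\eta_1,\dots,\eta_m\in R_{(0,1)}$ be almost regular for $R$ with respect to the $y$-degree; here $n$ and $m$ are the numbers of variables of $S$. Put $$s^x_i=\max\bigl(\{a : (0:_{R/(\xi_1,\dots,\xi_{i-1})R}\,\xi_i)_{(a,*)}\neq 0\}\cup\{0\}\bigr),\qquad s^x=\max\{s^x_1,\dots,s^x_n\},$$ $$s^y_i=\max\bigl(\{b : (0:_{R/(\eta_1,\dots,\eta_{i-1})R}\,\eta_i)_{(*,b)}\neq 0\}\cup\{0\}\bigr),\qquad s^y=\max\{s^y_1,\dots,s^y_m\}$$ (with $\max\emptyset=0$). Then $$\operatorname{reg}_x(R)=s^x\quad\text{and}\quad \operatorname{reg}_y(R)=s^y.$$ -/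

import Mathlib

universe u

noncomputable section

namespace Bigraded

/-- The polynomial ring `K[x_1, …, x_n, y_1, …, y_m]`. -/
abbrev PolyRing (K : Type u) [Field K] (n m : ℕ) : Type u := MvPolynomial (Fin n ⊕ Fin m) K

/-- `deg x_i = (1, 0)` and `deg y_j = (0, 1)`. -/
def varDeg (n m : ℕ) : Fin n ⊕ Fin m → ℤ × ℤ :=
  Sum.elim (fun _ => (1, 0)) (fun _ => (0, 1))

/-- The standard bigrading of the polynomial ring, indexed by `ℤ × ℤ`. -/
def piece (K : Type u) [Field K] (n m : ℕ) (c : ℤ × ℤ) : Submodule K (PolyRing K n m) :=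
  MvPolynomial.weightedHomogeneousSubmodule K (varDeg n m) c

instance pieceGradedAlgebra (K : Type u) [Field K] (n m : ℕ) : GradedAlgebra (piece K n m) :=
  MvPolynomial.weightedGradedAlgebra K (varDeg n m)

/-- The ideal `𝔪` generated by all variables; `S ⧸ 𝔪` is the residue field `K`. -/
def irrelevant (K : Type u) [Field K] (n m : ℕ) : Ideal (PolyRing K n m) :=
  Ideal.span (Set.range MvPolynomial.X)

section Quotients

variable {K : Type u} [Field K] {A : Type u} [CommRing A] [Algebra K A]

/-- The induced grading `(A ⧸ I)_c = image of A_c` on a quotient. -/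
def quotGrading (𝒜 : ℤ × ℤ → Submodule K A) (I : Ideal A) (c : ℤ × ℤ) : Submodule K (A ⧸ I) :=
  (𝒜 c).map (Ideal.Quotient.mkₐ K I).toLinearMap

/-- `(0 :_A r)_{(a, b)}`. -/
def annPiece (𝒜 : ℤ × ℤ → Submodule K A) (r : A) (c : ℤ × ℤ) : Submodule K A :=
  𝒜 c ⊓ LinearMap.ker (LinearMap.mulLeft K r)

/-- `(0 :_A r)_{(a, *)} = ⨁_b (0 :_A r)_{(a, b)}`. -/
def annX (𝒜 : ℤ × ℤ → Submodule K A) (r : A) (a : ℤ) : Submodule K A :=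
  ⨆ b : ℤ, annPiece 𝒜 r (a, b)

/-- `(0 :_A r)_{(*, b)} = ⨁_a (0 :_A r)_{(a, b)}`. -/
def annY (𝒜 : ℤ × ℤ → Submodule K A) (r : A) (b : ℤ) : Submodule K A :=
  ⨆ a : ℤ, annPiece 𝒜 r (a, b)

/-- The ideal `(r_1, …, r_{i-1})`. -/
def prevIdeal {t : ℕ} (r : Fin t → A) (i : Fin t) : Ideal A :=
  Ideal.span (r '' Set.Iio i)

/-- `(0 :_{A/(r_1, …, r_{i-1})} r_i)_{(a, *)}`. -/
def seqAnnX (𝒜 : ℤ × ℤ → Submodule K A) {t : ℕ} (r : Fin t → A) (i : Fin t) (a : ℤ) :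
    Submodule K (A ⧸ prevIdeal r i) :=
  annX (quotGrading 𝒜 (prevIdeal r i)) (Ideal.Quotient.mk (prevIdeal r i) (r i)) a

/-- `(0 :_{A/(r_1, …, r_{i-1})} r_i)_{(*, b)}`. -/
def seqAnnY (𝒜 : ℤ × ℤ → Submodule K A) {t : ℕ} (r : Fin t → A) (i : Fin t) (b : ℤ) :
    Submodule K (A ⧸ prevIdeal r i) :=
  annY (quotGrading 𝒜 (prevIdeal r i)) (Ideal.Quotient.mk (prevIdeal r i) (r i)) b

/-- Almost regular sequences with respect to the `x`-degree. -/
def IsAlmostRegularX (𝒜 : ℤ × ℤ → Submodule K A) {t : ℕ} (r : Fin t → A) : Prop :=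
  (∀ i, r i ∈ 𝒜 (1, 0)) ∧ ∀ i, ∃ a₀ : ℤ, ∀ a ≥ a₀, seqAnnX 𝒜 r i a = ⊥

/-- Almost regular sequences with respect to the `y`-degree. -/
def IsAlmostRegularY (𝒜 : ℤ × ℤ → Submodule K A) {t : ℕ} (r : Fin t → A) : Prop :=
  (∀ i, r i ∈ 𝒜 (0, 1)) ∧ ∀ i, ∃ b₀ : ℤ, ∀ b ≥ b₀, seqAnnY 𝒜 r i b = ⊥

/-- `s^x_i = max ({a | (0 :_{A/(r_1, …, r_{i-1})} r_i)_{(a, *)} ≠ 0} ∪ {0})`. -/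
def sXAt (𝒜 : ℤ × ℤ → Submodule K A) {t : ℕ} (r : Fin t → A) (i : Fin t) : ℕ :=
  sSup ({a : ℕ | seqAnnX 𝒜 r i a ≠ ⊥} ∪ {0})

/-- `s^y_i = max ({b | (0 :_{A/(r_1, …, r_{i-1})} r_i)_{(*, b)} ≠ 0} ∪ {0})`. -/
def sYAt (𝒜 : ℤ × ℤ → Submodule K A) {t : ℕ} (r : Fin t → A) (i : Fin t) : ℕ :=
  sSup ({b : ℕ | seqAnnY 𝒜 r i b ≠ ⊥} ∪ {0})

/-- `s^x = max {s^x_1, …, s^x_t}` (and `0` if `t = 0`). -/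
def sX (𝒜 : ℤ × ℤ → Submodule K A) {t : ℕ} (r : Fin t → A) : ℕ :=
  Finset.univ.sup (sXAt 𝒜 r)

/-- `s^y = max {s^y_1, …, s^y_t}` (and `0` if `t = 0`). -/
def sY (𝒜 : ℤ × ℤ → Submodule K A) {t : ℕ} (r : Fin t → A) : ℕ :=
  Finset.univ.sup (sYAt 𝒜 r)

end Quotients

section Resolutions

variable {K : Type u} [Field K] {n m : ℕ}

/-- The degree `c` part of the bigraded free module `⨁_j S(-deg j)`. -/
def freePiece {ι : Type u} (deg : ι → ℤ × ℤ) (c : ℤ × ℤ) :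
    Submodule K (ι →₀ PolyRing K n m) where
  carrier := {v | ∀ j, v j ∈ piece K n m (c - deg j)}
  add_mem' hv hw j := by
    rw [Finsupp.add_apply]
    exact add_mem (hv j) (hw j)
  zero_mem' j := by
    rw [Finsupp.zero_apply]
    exact zero_mem _
  smul_mem' r v hv j := by
    rw [Finsupp.smul_apply]
    exact Submodule.smul_mem _ r (hv j)

/-- Bigraded free resolutions
`⋯ → ⨁_j S(-deg 1 j) → ⨁_j S(-deg 0 j) → M → 0` of an `S`-module `M` with homogeneous parts
`ℳ c`; the maps are homogeneous of degree `0`. -/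
structure FreeResolution {M : Type u} [AddCommGroup M] [Module (PolyRing K n m) M] [Module K M]
    [IsScalarTower K (PolyRing K n m) M] (ℳ : ℤ × ℤ → Submodule K M) where
  ι : ℕ → Type u
  deg : ∀ i, ι i → ℤ × ℤ
  d : ∀ i, (ι (i + 1) →₀ PolyRing K n m) →ₗ[PolyRing K n m] (ι i →₀ PolyRing K n m)
  ε : (ι 0 →₀ PolyRing K n m) →ₗ[PolyRing K n m] M
  d_mem : ∀ i c, ∀ v ∈ freePiece (deg (i + 1)) c, d i v ∈ freePiece (deg i) c
  ε_mem : ∀ c, ∀ v ∈ freePiece (deg 0) c, ε v ∈ ℳ c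
  exact_d : ∀ i, Function.Exact (d (i + 1)) (d i)
  exact_ε : Function.Exact (d 0) ε
  surjective_ε : Function.Surjective ε

namespace FreeResolution

variable {M : Type u} [AddCommGroup M] [Module (PolyRing K n m) M] [Module K M]
  [IsScalarTower K (PolyRing K n m) M] {ℳ : ℤ × ℤ → Submodule K M}

/-- `K ⊗_S F_i = F_i ⧸ 𝔪 F_i`. -/
abbrev tensorObj (F : FreeResolution (n := n) (m := m) ℳ) (i : ℕ) : Type u :=
  (F.ι i →₀ PolyRing K n m) ⧸
    (irrelevant K n m • (⊤ : Submodule (PolyRing K n m) (F.ι i →₀ PolyRing K n m)))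

/-- The differential `K ⊗_S F_{i+1} → K ⊗_S F_i` induced by `F_{i+1} → F_i`. -/
def tensorD (F : FreeResolution (n := n) (m := m) ℳ) (i : ℕ) :
    F.tensorObj (i + 1) →ₗ[K] F.tensorObj i :=
  (Submodule.mapQ _ _ (F.d i) (Submodule.smul_top_le_comap_smul_top _ _)).restrictScalars K

/-- `(K ⊗_S F_i)_c`, the image of `(F_i)_c`. -/
def tensorPiece (F : FreeResolution (n := n) (m := m) ℳ) (i : ℕ) (c : ℤ × ℤ) :
    Submodule K (F.tensorObj i) :=
  (freePiece (F.deg i) c).map ((Submodule.mkQ _).restrictScalars K)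

/-- The `i`-cycles of degree `c` of `K ⊗_S F`. -/
def cycles (F : FreeResolution (n := n) (m := m) ℳ) (i : ℕ) (c : ℤ × ℤ) :
    Submodule K (F.tensorObj i) :=
  match i with
  | 0 => F.tensorPiece 0 c
  | i + 1 => F.tensorPiece (i + 1) c ⊓ LinearMap.ker (F.tensorD i)

/-- The `i`-boundaries of degree `c` of `K ⊗_S F`. -/
def boundaries (F : FreeResolution (n := n) (m := m) ℳ) (i : ℕ) (c : ℤ × ℤ) :
    Submodule K (F.tensorObj i) :=
  (F.tensorPiece (i + 1) c).map (F.tensorD i)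

/-- `Tor_i^S(K, M)_c = H_i(K ⊗_S F)_c`. -/
abbrev tor (F : FreeResolution (n := n) (m := m) ℳ) (i : ℕ) (c : ℤ × ℤ) : Type u :=
  F.cycles i c ⧸ (F.boundaries i c).submoduleOf (F.cycles i c)

end FreeResolution

end Resolutions

section Standard

variable {K : Type u} [Field K] {n m : ℕ}

/-- `Z` is a bigraded submodule: every element is a sum of homogeneous elements of `Z`. -/
def IsGradedSubmodule {ι : Type u} (deg : ι → ℤ × ℤ)
    (Z : Submodule (PolyRing K n m) (ι →₀ PolyRing K n m)) : Prop :=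
  Z.restrictScalars K ≤ ⨆ c, (Z.restrictScalars K ⊓ freePiece deg c)

theorem smul_mem_freePiece {ι : Type u} (deg : ι → ℤ × ℤ) {b c : ℤ × ℤ} {p : PolyRing K n m}
    {v : ι →₀ PolyRing K n m} (hp : p ∈ piece K n m b) (hv : v ∈ freePiece deg c) :
    p • v ∈ freePiece (K := K) deg (b + c) := by
  intro j
  have h := SetLike.mul_mem_graded hp (hv j)
  rw [Finsupp.smul_apply, smul_eq_mul, add_sub_assoc]
  exact h

theorem iSup_freePiece {ι : Type u} (deg : ι → ℤ × ℤ) :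
    (⨆ c, freePiece (K := K) (n := n) (m := m) deg c) = ⊤ := by
  rw [eq_top_iff]
  intro v _
  induction v using Finsupp.induction_linear with
  | zero => exact zero_mem _
  | add v w hv hw => exact add_mem (hv trivial) (hw trivial)
  | single j p =>
    classical
    rw [← DirectSum.sum_support_decompose (piece K n m) p, Finsupp.single_finsetSum]
    refine sum_mem fun b _ => Submodule.mem_iSup_of_mem (b + deg j) ?_
    intro k
    rw [Finsupp.single_apply]
    split_ifs with h
    · subst h
      rw [add_sub_cancel_right]
      exact SetLike.coe_mem _
    · exact zero_mem _

theorem eq_zero_of_sum_freePiece {ι : Type u} (deg : ι → ℤ × ℤ) (s : Finset (ℤ × ℤ))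
    (g : ℤ × ℤ → ι →₀ PolyRing K n m) (hg : ∀ c, g c ∈ freePiece (K := K) deg c)
    (h : ∑ c ∈ s, g c = 0) : ∀ c ∈ s, g c = 0 := by
  classical
  intro c hc
  refine Finsupp.ext fun j => ?_
  have h1 : ∑ b ∈ s, ((DirectSum.decompose (piece K n m) (g b j) (c - deg j) :
      piece K n m (c - deg j)) : PolyRing K n m) = 0 := by
    have h2 := congrArg (fun v : ι →₀ PolyRing K n m =>
      ((DirectSum.decompose (piece K n m) (v j) (c - deg j) :
        piece K n m (c - deg j)) : PolyRing K n m)) h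
    simpa [DirectSum.decompose_sum, DFinsupp.finsetSum_apply, Finsupp.finsetSum_apply] using h2
  rw [Finset.sum_eq_single c] at h1
  · rwa [DirectSum.decompose_of_mem_same _ (hg c j)] at h1
  · intro b _ hb
    exact DirectSum.decompose_of_mem_ne _ (hg b j) fun e => hb (sub_left_injective e)
  · exact fun h => absurd hc h

/-- The kernel of a homogeneous map of bigraded free modules is a bigraded submodule. -/
theorem isGradedSubmodule_ker {ι κ : Type u} (deg : ι → ℤ × ℤ) (deg' : κ → ℤ × ℤ)
    (f : (κ →₀ PolyRing K n m) →ₗ[PolyRing K n m] (ι →₀ PolyRing K n m))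
    (hf : ∀ c, ∀ v ∈ freePiece (K := K) deg' c, f v ∈ freePiece (K := K) deg c) :
    IsGradedSubmodule deg' (LinearMap.ker f) := by
  intro v hv
  have hv' : v ∈ ⨆ c, freePiece (K := K) deg' c := by
    rw [iSup_freePiece]
    trivial
  obtain ⟨g, hg, rfl⟩ := (Submodule.mem_iSup_iff_exists_finsupp _ _).mp hv'
  have h0 : ∑ c ∈ g.support, f (g c) = 0 := by
    rw [← map_sum]
    exact hv
  have h1 := eq_zero_of_sum_freePiece deg g.support (fun c => f (g c)) (fun c => hf c _ (hg c)) h0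
  exact sum_mem fun c hc => Submodule.mem_iSup_of_mem c ⟨h1 c hc, hg c⟩

/-- All homogeneous elements of `Z`. -/
abbrev HomogElem {ι : Type u} (deg : ι → ℤ × ℤ)
    (Z : Submodule (PolyRing K n m) (ι →₀ PolyRing K n m)) : Type u :=
  Σ c : ℤ × ℤ, ↥(Z.restrictScalars K ⊓ freePiece deg c)

/-- The free module on all homogeneous elements of `Z`, mapped onto `Z`. -/
def cover {ι : Type u} (deg : ι → ℤ × ℤ)
    (Z : Submodule (PolyRing K n m) (ι →₀ PolyRing K n m)) :
    (HomogElem deg Z →₀ PolyRing K n m) →ₗ[PolyRing K n m] (ι →₀ PolyRing K n m) :=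
  Finsupp.linearCombination (PolyRing K n m) fun z => (z.2 : ι →₀ PolyRing K n m)

theorem cover_mem {ι : Type u} (deg : ι → ℤ × ℤ)
    (Z : Submodule (PolyRing K n m) (ι →₀ PolyRing K n m)) (c : ℤ × ℤ)
    (v : HomogElem deg Z →₀ PolyRing K n m)
    (hv : v ∈ freePiece (K := K) (fun z : HomogElem deg Z => z.1) c) :
    cover deg Z v ∈ freePiece (K := K) deg c := by
  rw [cover, Finsupp.linearCombination_apply]
  refine sum_mem fun z _ => ?_
  have h := smul_mem_freePiece deg (hv z) z.2.2.2
  rwa [sub_add_cancel] at h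

theorem range_cover {ι : Type u} (deg : ι → ℤ × ℤ)
    (Z : Submodule (PolyRing K n m) (ι →₀ PolyRing K n m)) (hZ : IsGradedSubmodule deg Z) :
    LinearMap.range (cover deg Z) = Z := by
  refine le_antisymm ?_ ?_
  · rw [cover, Finsupp.range_linearCombination, Submodule.span_le]
    rintro _ ⟨z, rfl⟩
    exact z.2.2.1
  · have h : (⨆ c, (Z.restrictScalars K ⊓ freePiece deg c)) ≤
        (LinearMap.range (cover deg Z)).restrictScalars K := by
      refine iSup_le fun c v hv => ?_
      refine ⟨Finsupp.single ⟨c, v, hv⟩ 1, ?_⟩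
      rw [cover, Finsupp.linearCombination_single, one_smul]
    exact fun v hv => h (hZ hv)

/-- A bigraded free module together with a bigraded submodule. -/
structure Stage (K : Type u) [Field K] (n m : ℕ) where
  ι : Type u
  deg : ι → ℤ × ℤ
  Z : Submodule (PolyRing K n m) (ι →₀ PolyRing K n m)
  graded : IsGradedSubmodule deg Z

/-- Cover `Z` by the free module on its homogeneous elements and pass to the kernel. -/
def Stage.next (s : Stage K n m) : Stage K n m where
  ι := HomogElem s.deg s.Z
  deg z := z.1
  Z := LinearMap.ker (cover s.deg s.Z)
  graded := isGradedSubmodule_ker s.deg _ _ (cover_mem s.deg s.Z)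

/-- The projection `S → S ⧸ J`, where `S` is the free module on one generator of degree `(0, 0)`. -/
def proj (J : HomogeneousIdeal (piece K n m)) :
    (PUnit.{u + 1} →₀ PolyRing K n m) →ₗ[PolyRing K n m] (PolyRing K n m ⧸ J.toIdeal) :=
  (Submodule.mkQ J.toIdeal).comp (Finsupp.lapply PUnit.unit)

theorem isGradedSubmodule_ker_proj (J : HomogeneousIdeal (piece K n m)) :
    IsGradedSubmodule (fun _ => 0) (LinearMap.ker (proj J)) := by
  classical
  intro v hv
  have hp : v PUnit.unit ∈ J.toIdeal := (Submodule.Quotient.mk_eq_zero _).mp hv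
  have hv1 : v = Finsupp.single PUnit.unit (v PUnit.unit) := by
    refine Finsupp.ext fun j => ?_
    cases j
    rw [Finsupp.single_eq_same]
  rw [hv1, ← DirectSum.sum_support_decompose (piece K n m) (v PUnit.unit),
    Finsupp.single_finsetSum]
  refine sum_mem fun c _ => Submodule.mem_iSup_of_mem c ⟨?_, ?_⟩
  · refine (Submodule.Quotient.mk_eq_zero _).mpr ?_
    rw [Finsupp.lapply_apply, Finsupp.single_eq_same]
    exact J.isHomogeneous c hp
  · intro j
    cases j
    rw [Finsupp.single_eq_same, sub_zero]
    exact SetLike.coe_mem _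

theorem exact_cover (s : Stage K n m) :
    Function.Exact (cover s.next.deg s.next.Z) (cover s.deg s.Z) :=
  LinearMap.exact_iff.mpr (range_cover s.next.deg s.next.Z s.next.graded).symm

theorem exact_proj (J : HomogeneousIdeal (piece K n m)) :
    Function.Exact (cover (fun _ => 0) (LinearMap.ker (proj J))) (proj J) :=
  LinearMap.exact_iff.mpr (range_cover _ _ (isGradedSubmodule_ker_proj J)).symm

/-- The stages of the standard resolution of `S ⧸ J`. -/
def stage (J : HomogeneousIdeal (piece K n m)) : ℕ → Stage K n m
  | 0 => ⟨PUnit, fun _ => 0, LinearMap.ker (proj J), isGradedSubmodule_ker_proj J⟩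
  | i + 1 => (stage J i).next

/-- The standard bigraded free resolution of `S ⧸ J`: it starts with `S → S ⧸ J`, and each further
term is the free module on all homogeneous elements of the preceding kernel. -/
def standardResolution (J : HomogeneousIdeal (piece K n m)) :
    FreeResolution (n := n) (m := m) (quotGrading (piece K n m) J.toIdeal) where
  ι i := (stage J i).ι
  deg i := (stage J i).deg
  d i := cover (stage J i).deg (stage J i).Z
  ε := proj J
  d_mem i c v hv := cover_mem _ _ c v hv
  ε_mem c v hv := ⟨v PUnit.unit, by simpa [stage] using hv PUnit.unit, rfl⟩
  exact_d i := exact_cover (stage J i)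
  exact_ε := exact_proj J
  surjective_ε r := by
    obtain ⟨p, rfl⟩ := Submodule.mkQ_surjective _ r
    exact ⟨Finsupp.single PUnit.unit p, congrArg (Submodule.mkQ _) Finsupp.single_eq_same⟩

/-- The bigraded Betti number `β_{i, c}(S ⧸ J) = dim_K Tor_i^S(K, S ⧸ J)_c`; up to isomorphism,
the graded `Tor` does not depend on the bigraded free resolution that computes it. -/
def betti (J : HomogeneousIdeal (piece K n m)) (i : ℕ) (c : ℤ × ℤ) : Cardinal.{u} :=
  Module.rank K ((standardResolution J).tor i c)

/-- `reg_x(S ⧸ J) = sup {a | β_{i, (a + i, b)}(S ⧸ J) ≠ 0 for some i, b}`. -/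
def regX (J : HomogeneousIdeal (piece K n m)) : EReal :=
  sSup {r | ∃ a : ℤ, r = ((a : ℝ) : EReal) ∧ ∃ (i : ℕ) (b : ℤ), betti J i (a + i, b) ≠ 0}

/-- `reg_y(S ⧸ J) = sup {b | β_{i, (a, b + i)}(S ⧸ J) ≠ 0 for some i, a}`. -/
def regY (J : HomogeneousIdeal (piece K n m)) : EReal :=
  sSup {r | ∃ b : ℤ, r = ((b : ℝ) : EReal) ∧ ∃ (i : ℕ) (a : ℤ), betti J i (a, b + i) ≠ 0}

end Standard

end Bigraded

end

noncomputable section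

namespace Bigraded

/-! ### Exactness of the `Tor` sequences attached to a form `z`, one bidegree at a time -/

section Homology

variable {K : Type u} [Field K] {n m : ℕ}

/-! Call `a` the degree under study and `b` the other one. Let `z_0, …, z_{N-1}` be a basis of the
`p` linear forms of the first kind followed by the variables of the second kind, `I_k = (z_0, …,
z_{k-1})` and `T^k_i = Tor_i(S/I_k, R)`. This is a regular sequence on `S` with `I_N = 𝔪`, so the
`T^N_i` are the groups defining the regularity, and `0 → S/I_k(-e) → S/I_k → S/I_{k+1} → 0` gives
long exact sequences, in which `(0 :_{R/I_k R} z_k)` is the image of `T^{k+1}_1`.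

Upper bound (`vanishes_x`, `vanishes_xy`). Start from `T^0_i = 0` for `i > 0`. For `k < p` a
connecting map lowers both `i` and `a` by one, and the annihilators vanish for `a > s`; hence
`T^k_i`, `i > 0`, vanishes for `a > s + i`. As `R/I_p R` vanishes for `a > 0`, this then holds for
`i = 0` too, and forms of the second kind preserve it.

Lower bound (`exists_not_vanishes`). A nonzero annihilator in the extremal degree `s` comes from
`T^{k+1}_1` in degree `s + 1`. Multiplication by the next form lands beyond the upper bound, so the
class lifts to `T^{k+2}_2` in degree `s + 2`, and so on until `I_p` is reached. There take the least
`b` with a nonzero class: multiplication by a form of the second kind into that degree starts from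
zero, so the class survives down to `𝔪`. If `s = 0`, the class of `1` in `Tor_0` suffices.

Lifts to `S` of the given sequence need not be independent; `betti_of_forms` replaces them by a
basis from the first dependent one on. The `y`-statement is the `x`-statement with the two groups of
variables interchanged. -/

theorem mem_smul_top_iff_forall {R ι : Type*} [CommRing R] (I : Ideal R) (v : ι →₀ R) :
    v ∈ I • (⊤ : Submodule R (ι →₀ R)) ↔ ∀ j, v j ∈ I := by
  constructor
  · intro hv j
    have h : I • (⊤ : Submodule R (ι →₀ R)) ≤ Submodule.comap (Finsupp.lapply j) I :=
      Submodule.smul_le.mpr fun r hr w _ => by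
        simpa using I.mul_mem_right _ hr
    exact h hv
  · intro h
    rw [← Finsupp.sum_single v]
    refine sum_mem fun j _ => ?_
    have e : Finsupp.single j (v j) = v j • Finsupp.single j (1 : R) := by simp
    rw [e]
    exact Submodule.smul_mem_smul (h j) trivial

theorem map_mem_smul_top {R M N : Type*} [CommRing R] [AddCommGroup M] [Module R M]
    [AddCommGroup N] [Module R N] {I : Ideal R} (f : M →ₗ[R] N) {v : M}
    (hv : v ∈ I • (⊤ : Submodule R M)) : f v ∈ I • (⊤ : Submodule R N) :=
  Submodule.smul_top_le_comap_smul_top I f hv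

theorem mem_smul_top_of_smul_mem {R ι : Type*} [CommRing R] {I : Ideal R} {z : R}
    (hz : ∀ r, z * r ∈ I → r ∈ I) {v : ι →₀ R} (hv : z • v ∈ I • (⊤ : Submodule R (ι →₀ R))) :
    v ∈ I • (⊤ : Submodule R (ι →₀ R)) := by
  rw [mem_smul_top_iff_forall] at hv ⊢
  exact fun j => hz _ (hv j)

/-- A homogeneous element of `I + (z)` is congruent modulo `I` to a homogeneous multiple of `z`. -/
theorem exists_homogeneous_sub_mul_mem {I : Ideal (PolyRing K n m)}
    (hI : I.IsHomogeneous (piece K n m)) {z : PolyRing K n m} {e c c' : ℤ × ℤ}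
    (hz : z ∈ piece K n m e) (hc : c' + e = c) {p : PolyRing K n m} (hp : p ∈ piece K n m c)
    (hpI : p ∈ I ⊔ Ideal.span {z}) : ∃ q ∈ piece K n m c', p - z * q ∈ I := by
  classical
  obtain ⟨r, hr, s, hs, rfl⟩ := Submodule.mem_sup.mp hpI
  obtain ⟨t, rfl⟩ := Ideal.mem_span_singleton'.mp hs
  -- In degree `c` only the degree `c'` component of the cofactor `t` meets `z`; what remains is a
  -- component of `r`, in `I` by homogeneity.
  refine ⟨DirectSum.decompose (piece K n m) t c', SetLike.coe_mem _, ?_⟩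
  have h1 : ((DirectSum.decompose (piece K n m) (r + t * z) c : piece K n m c) :
      PolyRing K n m) = r + t * z := DirectSum.decompose_of_mem_same _ hp
  rw [DirectSum.decompose_add, DirectSum.add_apply, Submodule.coe_add, ← hc,
    DirectSum.coe_decompose_mul_add_of_right_mem _ hz] at h1
  rw [← h1, mul_comm z, add_sub_cancel_right]
  exact hI _ hr

theorem exists_freePiece_sub_smul_mem {ι : Type u} {deg : ι → ℤ × ℤ} {I : Ideal (PolyRing K n m)}
    (hI : I.IsHomogeneous (piece K n m)) {z : PolyRing K n m} {e c c' : ℤ × ℤ}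
    (hz : z ∈ piece K n m e) (hc : c' + e = c) {v : ι →₀ PolyRing K n m}
    (hv : v ∈ freePiece (K := K) deg c) (hvI : v ∈ (I ⊔ Ideal.span {z}) •
      (⊤ : Submodule (PolyRing K n m) (ι →₀ PolyRing K n m))) :
    ∃ w ∈ freePiece (K := K) deg c', v - z • w ∈
      I • (⊤ : Submodule (PolyRing K n m) (ι →₀ PolyRing K n m)) := by
  classical
  rw [mem_smul_top_iff_forall] at hvI
  have h (j) : ∃ q ∈ piece K n m (c' - deg j), v j - z * q ∈ I :=
    exists_homogeneous_sub_mul_mem hI hz (by rw [← hc]; abel) (hv j) (hvI j)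
  choose q hq hq' using h
  -- The chosen `q j` may be nonzero where `v j = 0`; forcing `0` there keeps the support finite.
  refine ⟨Finsupp.onFinset v.support (fun j => if v j = 0 then 0 else q j) (by simp +contextual),
    fun j => ?_, ?_⟩
  · rw [Finsupp.onFinset_apply]
    split_ifs
    exacts [zero_mem _, hq j]
  · rw [mem_smul_top_iff_forall]
    intro j
    rw [Finsupp.sub_apply, Finsupp.smul_apply, Finsupp.onFinset_apply]
    split_ifs with h0
    · simp [h0]
    · exact hq' j

namespace FreeResolution

variable {M : Type u} [AddCommGroup M] [Module (PolyRing K n m) M] [Module K M]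
  [IsScalarTower K (PolyRing K n m) M] {ℳ : ℤ × ℤ → Submodule K M}

/-- `Tor_i^S(S ⧸ I, M)_c = H_i(F ⧸ I F)_c` vanishes. -/
def TorVanishes (F : FreeResolution (n := n) (m := m) ℳ) (I : Ideal (PolyRing K n m)) :
    ℕ → ℤ × ℤ → Prop
  | 0, c => ∀ v ∈ freePiece (K := K) (F.deg 0) c, ∃ w ∈ freePiece (K := K) (F.deg 1) c,
      v - F.d 0 w ∈ I • (⊤ : Submodule (PolyRing K n m) (F.ι 0 →₀ PolyRing K n m))
  | i + 1, c => ∀ v ∈ freePiece (K := K) (F.deg (i + 1)) c,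
      F.d i v ∈ I • (⊤ : Submodule (PolyRing K n m) (F.ι i →₀ PolyRing K n m)) →
      ∃ w ∈ freePiece (K := K) (F.deg (i + 2)) c,
        v - F.d (i + 1) w ∈ I • (⊤ : Submodule (PolyRing K n m) (F.ι (i + 1) →₀ PolyRing K n m))

/-- The annihilator of `z`, of degree `e`, in `M ⧸ I M` vanishes in degree `c`. -/
def ColonVanishes (F : FreeResolution (n := n) (m := m) ℳ) (I : Ideal (PolyRing K n m))
    (z : PolyRing K n m) (e c : ℤ × ℤ) : Prop :=
  ∀ u ∈ freePiece (K := K) (F.deg 0) c, (∃ v ∈ freePiece (K := K) (F.deg 1) (c + e),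
      z • u - F.d 0 v ∈ I • (⊤ : Submodule (PolyRing K n m) (F.ι 0 →₀ PolyRing K n m))) →
    ∃ w ∈ freePiece (K := K) (F.deg 1) c,
      u - F.d 0 w ∈ I • (⊤ : Submodule (PolyRing K n m) (F.ι 0 →₀ PolyRing K n m))

variable {F : FreeResolution (n := n) (m := m) ℳ} {I I' : Ideal (PolyRing K n m)}
  {z : PolyRing K n m} {e c : ℤ × ℤ} {i : ℕ}

theorem d_comp_d (F : FreeResolution (n := n) (m := m) ℳ) (i : ℕ)
    (v : F.ι (i + 2) →₀ PolyRing K n m) : F.d i (F.d (i + 1) v) = 0 :=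
  (F.exact_d i).apply_apply_eq_zero v

theorem TorVanishes.zero_mono (h : F.TorVanishes I 0 c) (hI : I ≤ I') : F.TorVanishes I' 0 c :=
  fun v hv => (h v hv).imp fun _ hw => ⟨hw.1, Submodule.smul_mono_left hI hw.2⟩

theorem TorVanishes.colonVanishes (h : F.TorVanishes I 0 c) : F.ColonVanishes I z e c :=
  fun u hu _ => h u hu

theorem smul_mem_smul_top_sup {N : Type u} [AddCommGroup N] [Module (PolyRing K n m) N] (v : N) :
    z • v ∈ (I ⊔ Ideal.span {z}) • (⊤ : Submodule (PolyRing K n m) N) :=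
  Submodule.smul_mem_smul (le_sup_right (a := I) (Ideal.mem_span_singleton_self z)) trivial

theorem mem_smul_top_sup_of_left {N : Type u} [AddCommGroup N] [Module (PolyRing K n m) N] {v : N}
    (hv : v ∈ I • (⊤ : Submodule (PolyRing K n m) N)) :
    v ∈ (I ⊔ Ideal.span {z}) • (⊤ : Submodule (PolyRing K n m) N) :=
  Submodule.smul_mono_left le_sup_left hv

theorem smul_mem_freePiece_add {ι : Type u} {deg : ι → ℤ × ℤ} (hz : z ∈ piece K n m e)
    {v : ι →₀ PolyRing K n m} (hv : v ∈ freePiece (K := K) deg c) :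
    z • v ∈ freePiece (K := K) deg (c + e) := by
  rw [add_comm]
  exact smul_mem_freePiece deg hz hv

section

variable (hI : I.IsHomogeneous (piece K n m)) (hz : z ∈ piece K n m e)
include hI hz

/-- Exactness of `Tor_1(S/I, M) → Tor_1(S/(I + z), M) → (0 :_{M/IM} z)(-e)` in the middle. -/
theorem TorVanishes.sup_one (h : F.TorVanishes I 1 (c + e)) (hA : F.ColonVanishes I z e c) :
    F.TorVanishes (I ⊔ Ideal.span {z}) 1 (c + e) := by
  intro v hv hdv
  obtain ⟨u, hu, hvu⟩ := exists_freePiece_sub_smul_mem hI hz rfl (F.d_mem 0 _ v hv) hdv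
  obtain ⟨w, hw, huw⟩ := hA u hu ⟨v, hv, by simpa using neg_mem hvu⟩
  -- Subtracting `z • w` changes `v` only modulo `z` and turns it into a cycle modulo `I`, because
  -- `d v ≡ z u ≡ z d w`.
  obtain ⟨t, ht, hvt⟩ := h (v - z • w) (sub_mem hv (smul_mem_freePiece_add hz hw)) (by
    have := add_mem hvu (Submodule.smul_mem _ z huw)
    rw [smul_sub, sub_add_sub_cancel] at this
    simpa using this)
  refine ⟨t, ht, ?_⟩
  have := add_mem (mem_smul_top_sup_of_left (z := z) hvt) (smul_mem_smul_top_sup (I := I) (z := z) w)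
  convert this using 1
  abel

variable (hreg : ∀ r, z * r ∈ I → r ∈ I)
include hreg

/-- Exactness of `Tor_i(S/I, M) → Tor_i(S/(I + z), M) → Tor_{i-1}(S/I, M)(-e)` in the middle. -/
theorem TorVanishes.sup_succ (h : F.TorVanishes I (i + 2) (c + e))
    (hA : F.TorVanishes I (i + 1) c) : F.TorVanishes (I ⊔ Ideal.span {z}) (i + 2) (c + e) := by
  intro v hv hdv
  obtain ⟨u, hu, hvu⟩ := exists_freePiece_sub_smul_mem hI hz rfl (F.d_mem (i + 1) _ v hv) hdv
  -- `u` is a cycle modulo `I`: `z d u ≡ d (d v) = 0`, and `z` cancels.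
  obtain ⟨w, hw, huw⟩ := hA u hu (by
    refine mem_smul_top_of_smul_mem hreg ?_
    have := map_mem_smul_top (F.d i) hvu
    rw [map_sub, d_comp_d, zero_sub, map_smul] at this
    simpa using neg_mem this)
  obtain ⟨t, ht, hvt⟩ := h (v - z • w) (sub_mem hv (smul_mem_freePiece_add hz hw)) (by
    have := add_mem hvu (Submodule.smul_mem _ z huw)
    rw [smul_sub, sub_add_sub_cancel] at this
    simpa using this)
  refine ⟨t, ht, ?_⟩
  have := add_mem (mem_smul_top_sup_of_left (z := z) hvt) (smul_mem_smul_top_sup (I := I) (z := z) w)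
  convert this using 1
  abel

/-- If `z u` is a boundary modulo `I` and the corresponding class of `H_{i+1}(F/(I + z)F)`
vanishes, then `u` is a boundary modulo `I`. -/
theorem exists_sub_d_mem {u : F.ι i →₀ PolyRing K n m} {v : F.ι (i + 1) →₀ PolyRing K n m}
    (h : F.TorVanishes (I ⊔ Ideal.span {z}) (i + 1) (c + e))
    (hv : v ∈ freePiece (K := K) (F.deg (i + 1)) (c + e))
    (huv : z • u - F.d i v ∈ I • (⊤ : Submodule (PolyRing K n m) (F.ι i →₀ PolyRing K n m))) :
    ∃ w ∈ freePiece (K := K) (F.deg (i + 1)) c,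
      u - F.d i w ∈ I • (⊤ : Submodule (PolyRing K n m) (F.ι i →₀ PolyRing K n m)) := by
  obtain ⟨t, ht, hvt⟩ := h v hv (by
    have := sub_mem (smul_mem_smul_top_sup (I := I) (z := z) u) (mem_smul_top_sup_of_left huv)
    rwa [sub_sub_cancel] at this)
  obtain ⟨w, hw, hvw⟩ := exists_freePiece_sub_smul_mem hI hz rfl
    (sub_mem hv (F.d_mem (i + 1) _ t ht)) hvt
  -- Modulo `I`, `z u ≡ d v = d (v - d t) ≡ z d w`; cancel `z`.
  refine ⟨w, hw, mem_smul_top_of_smul_mem hreg ?_⟩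
  have := add_mem huv (map_mem_smul_top (F.d i) hvw)
  rw [map_sub, map_sub, d_comp_d, sub_zero, map_smul, sub_add_sub_cancel, ← smul_sub] at this
  exact this

/-- Surjectivity of `Tor_1(S/(I + z), M) → (0 :_{M/IM} z)(-e)`. -/
theorem TorVanishes.colonVanishes_of_sup (h : F.TorVanishes (I ⊔ Ideal.span {z}) 1 (c + e)) :
    F.ColonVanishes I z e c := by
  rintro u hu ⟨v, hv, huv⟩
  exact exists_sub_d_mem hI hz hreg h hv huv

/-- Exactness of `Tor_{i+1}(S/(I + z), M) → Tor_i(S/I, M)(-e) → Tor_i(S/I, M)` in the middle. -/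
theorem TorVanishes.of_sup_succ (h : F.TorVanishes (I ⊔ Ideal.span {z}) (i + 2) (c + e))
    (h' : F.TorVanishes I (i + 1) (c + e)) : F.TorVanishes I (i + 1) c := by
  intro u hu hdu
  obtain ⟨v, hv, huv⟩ := h' (z • u) (smul_mem_freePiece_add hz hu) (by
    rw [map_smul]
    exact Submodule.smul_mem _ z hdu)
  exact exists_sub_d_mem hI hz hreg h hv huv

/-- Exactness of `Tor_i(S/I, M)(-e) → Tor_i(S/I, M) → Tor_i(S/(I + z), M)` in the middle. -/
theorem TorVanishes.of_sup (h : F.TorVanishes I (i + 1) c)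
    (h' : F.TorVanishes (I ⊔ Ideal.span {z}) (i + 1) (c + e)) :
    F.TorVanishes I (i + 1) (c + e) := by
  intro v hv hdv
  obtain ⟨t, ht, hvt⟩ := h' v hv (mem_smul_top_sup_of_left hdv)
  obtain ⟨w, hw, hvw⟩ := exists_freePiece_sub_smul_mem hI hz rfl
    (sub_mem hv (F.d_mem (i + 1) _ t ht)) hvt
  obtain ⟨t', ht', hwt⟩ := h w hw (by
    refine mem_smul_top_of_smul_mem hreg ?_
    have := sub_mem hdv (map_mem_smul_top (F.d i) hvw)
    rw [map_sub, map_sub, d_comp_d, sub_zero, map_smul, sub_sub_cancel] at this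
    exact this)
  -- Modulo `I`, `v ≡ d t + z w` and `w ≡ d t'`.
  refine ⟨t + z • t', add_mem ht (smul_mem_freePiece_add hz ht'), ?_⟩
  have := add_mem hvw (Submodule.smul_mem _ z hwt)
  rw [smul_sub, sub_add_sub_cancel] at this
  rw [map_add, map_smul, ← sub_sub]
  exact this

end

end FreeResolution

end Homology

/-! ### Diagram chase: propagating vanishing and nonvanishing along the sequence -/

section LongExactSequences

/-- Formal consequences of the long exact sequences of `Tor_i(S/(z_0, …, z_{k-1}), M)` that arise
from adjoining first `p` elements of degree `(1, 0)` and then `N - p` elements of degree `(0, 1)`.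
`V k i a b` says that `Tor_i(S/(z_0, …, z_{k-1}), M)` vanishes in degree `(a, b)`, and `A k a b`
says that the annihilator of `z_k` in `M/(z_0, …, z_{k-1})M` does. -/
structure LongExactData (p N : ℕ) (V : ℕ → ℕ → ℤ → ℤ → Prop) (A : ℕ → ℤ → ℤ → Prop) : Prop where
  le : p ≤ N
  start : ∀ i a b, V 0 (i + 1) a b
  start_neg : ∀ a b, b < 0 → V 0 0 a b
  mono : ∀ k < N, ∀ a b, V k 0 a b → V (k + 1) 0 a b
  end_pos : ∀ a b, 0 < a → V p 0 a b
  colon : ∀ k < p, ∀ a b, V k 0 a b → A k a b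
  x_one : ∀ k < p, ∀ a b, V k 1 (a + 1) b → A k a b → V (k + 1) 1 (a + 1) b
  x_succ : ∀ k < p, ∀ i a b, V k (i + 2) (a + 1) b → V k (i + 1) a b →
    V (k + 1) (i + 2) (a + 1) b
  x_colon : ∀ k < p, ∀ a b, V (k + 1) 1 (a + 1) b → A k a b
  x_left : ∀ k < p, ∀ i a b, V (k + 1) (i + 2) (a + 1) b → V k (i + 1) (a + 1) b →
    V k (i + 1) a b
  y_succ : ∀ k, p ≤ k → k < N → ∀ i a b, V k (i + 1) a (b + 1) → V k i a b →
    V (k + 1) (i + 1) a (b + 1)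
  y_right : ∀ k, p ≤ k → k < N → ∀ i a b, V k (i + 1) a b → V (k + 1) (i + 1) a (b + 1) →
    V k (i + 1) a (b + 1)

namespace LongExactData

variable {p N : ℕ} {V : ℕ → ℕ → ℤ → ℤ → Prop} {A : ℕ → ℤ → ℤ → Prop} {s : ℕ}

/-- Homological degree and `a` drop together along the connecting map, so the bound is stable in
`k`. Degree `0` is excluded, since `R` itself may be unbounded in `a`; its role is played by the
annihilators. -/
theorem vanishes_x (h : LongExactData p N V A) (hA : ∀ k < p, ∀ a b, (s : ℤ) < a → A k a b) :
    ∀ k ≤ p, ∀ (i : ℕ) (a b : ℤ), (s : ℤ) < a → V k (i + 1) (a + i + 1) b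
  | 0, _, i, a, b, _ => h.start i _ b
  | k + 1, hk, 0, a, b, ha => by
    have h1 := h.vanishes_x hA k (by omega) 0 a b ha
    simp only [Nat.cast_zero, add_zero] at h1 ⊢
    exact h.x_one k hk a b h1 (hA k hk a b ha)
  | k + 1, hk, i + 1, a, b, ha => by
    have h1 := h.vanishes_x hA k (by omega) (i + 1) a b ha
    have h2 := h.vanishes_x hA k (by omega) i a b ha
    push_cast at h1 ⊢
    rw [← add_assoc] at h1 ⊢
    exact h.x_succ k hk i _ b h1 h2

/-- Guarantees that a least `b` carrying a nonzero class exists. -/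
theorem vanishes_neg (h : LongExactData p N V A) :
    ∀ k ≤ p, ∀ (i : ℕ) (a b : ℤ), b < 0 → V k i a b
  | 0, _, 0, a, b, hb => h.start_neg a b hb
  | 0, _, i + 1, a, b, _ => h.start i a b
  | k + 1, hk, 0, a, b, hb =>
    h.mono k (by have := h.le; omega) a b (h.vanishes_neg k (by omega) 0 a b hb)
  | k + 1, hk, 1, a, b, hb => by
    have := h.x_one k hk (a - 1) b
    rw [sub_add_cancel] at this
    exact this (h.vanishes_neg k (by omega) 1 a b hb)
      (h.colon k hk _ b (h.vanishes_neg k (by omega) 0 (a - 1) b hb))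
  | k + 1, hk, i + 2, a, b, hb => by
    have := h.x_succ k hk i (a - 1) b
    rw [sub_add_cancel] at this
    exact this (h.vanishes_neg k (by omega) _ a b hb) (h.vanishes_neg k (by omega) _ (a - 1) b hb)

theorem vanishes_xy (h : LongExactData p N V A) (hA : ∀ k < p, ∀ a b, (s : ℤ) < a → A k a b)
    (k : ℕ) (hpk : p ≤ k) (hk : k ≤ N) :
    ∀ (i : ℕ) (a b : ℤ), (s : ℤ) < a → V k i (a + i) b := by
  induction k, hpk using Nat.le_induction with
  | base =>
    rintro (_ | i) a b ha
    · exact h.end_pos _ b (by push_cast; omega)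
    · have := h.vanishes_x hA p le_rfl i a b ha
      push_cast
      rwa [← add_assoc]
  | succ k hpk ih =>
    rintro (_ | i) a b ha
    · exact h.mono k hk _ b (ih (by omega) 0 a b ha)
    · have h1 := ih (by omega) (i + 1) a b ha
      -- The connecting map now lowers `b` and not `a`, so `a + (i + 1)` is read as `(a + 1) + i`,
      -- one further beyond the bound.
      have h2 := ih (by omega) i (a + 1) (b - 1) (by omega)
      have h3 := h.y_succ k hpk hk i (a + (i + 1 : ℕ)) (b - 1)
      rw [sub_add_cancel] at h3
      refine h3 h1 ?_
      convert h2 using 1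
      push_cast
      ring

/-- In the top degree `s + j + 1`, multiplication by the next form has zero target by `vanishes_x`;
hence every class there is hit by the connecting map from one homological degree higher. -/
theorem not_vanishes_x (h : LongExactData p N V A)
    (hA : ∀ k < p, ∀ a b, (s : ℤ) < a → A k a b) {k : ℕ} {b : ℤ} (hk : k < p)
    (hs : ¬ A k s b) : ∀ j : ℕ, k + j < p → ¬ V (k + j + 1) (j + 1) (s + j + 1) b
  | 0, _ => fun h1 => hs (h.x_colon k hk s b (by simpa using h1))
  | j + 1, hj => fun h1 => by
    refine h.not_vanishes_x hA hk hs j (by omega) ?_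
    have h2 := h.vanishes_x hA (k + j + 1) (by omega) j (s + 1) b (by omega)
    refine h.x_left (k + j + 1) (by omega) j _ b ?_ ?_
    · have e : (s : ℤ) + j + 1 + 1 = s + (j + 1 : ℕ) + 1 := by push_cast; ring
      rw [e]
      exact h1
    · convert h2 using 1
      ring

theorem exists_not_vanishes (h : LongExactData p N V A)
    (hA : ∀ k < p, ∀ a b, (s : ℤ) < a → A k a b) {k : ℕ} {b : ℤ} (hk : k < p)
    (hs : ¬ A k s b) : ∃ (i : ℕ) (b : ℤ), ¬ V N i (s + i) b := by
  obtain ⟨j, rfl⟩ : ∃ j, p = k + j + 1 := ⟨p - k - 1, by omega⟩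
  have h1 := h.not_vanishes_x hA hk hs j (by omega)
  obtain ⟨b₀, hb₀, hmin⟩ := Int.exists_least_of_bdd
    (P := fun b => ¬ V (k + j + 1) (j + 1) (s + j + 1) b)
    ⟨0, fun b hb => by
      by_contra hb'
      exact hb (h.vanishes_neg _ le_rfl _ _ b (by omega))⟩ ⟨b, h1⟩
  refine ⟨j + 1, b₀, ?_⟩
  -- Both halves are needed: vanishing below `b₀` makes the map to the next stage injective in
  -- degree `b₀`, and is itself inherited.
  have key : ∀ l, k + j + 1 ≤ l → l ≤ N →
      (∀ b < b₀, V l (j + 1) (s + j + 1) b) ∧ ¬ V l (j + 1) (s + j + 1) b₀ := by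
    intro l hl
    induction l, hl using Nat.le_induction with
    | base =>
      refine fun _ => ⟨fun b hb => ?_, hb₀⟩
      by_contra hb'
      have := hmin b hb'
      omega
    | succ l hl ih =>
      intro hlN
      obtain ⟨ih1, ih2⟩ := ih (by omega)
      refine ⟨fun b hb => ?_, fun h3 => ih2 ?_⟩
      · have h2 := h.vanishes_xy hA l hl (by omega) j (s + 1) (b - 1) (by omega)
        have h3 := h.y_succ l hl hlN j (s + j + 1) (b - 1)
        rw [sub_add_cancel] at h3
        refine h3 (ih1 b hb) ?_
        convert h2 using 1
        ring
      · have h4 := h.y_right l hl hlN j (s + j + 1) (b₀ - 1) (ih1 _ (by omega))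
        rw [sub_add_cancel] at h4
        exact h4 h3
  have := (key N h.le le_rfl).2
  push_cast
  rwa [← add_assoc]

end LongExactData

end LongExactSequences

/-! ### Algebra for regular sequences and for completing linear forms to a basis -/

section LinearForms

/-- The kernels of the powers of `f` stabilize, say at `N`. If `f r = 0` and `r = f^N t`, then `t ∈
ker f^(N+1) = ker f^N`, so `r = 0`. -/
theorem injective_of_surjective_ringHom {R : Type*} [CommRing R] [IsNoetherianRing R]
    (f : R →+* R) (hf : Function.Surjective f) : Function.Injective f := by
  let g : ℕ →o Ideal R :=
    { toFun k := RingHom.ker (f ^ k)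
      monotone' := monotone_nat_of_le_succ fun k r hr => by
        rw [RingHom.mem_ker] at hr ⊢
        rw [pow_succ', RingHom.mul_def, RingHom.comp_apply, hr, map_zero] }
  obtain ⟨N, hN⟩ := monotone_stabilizes_iff_noetherian.mpr (inferInstance : IsNoetherian R R) g
  rw [injective_iff_map_eq_zero]
  intro r hr
  have hs : Function.Surjective (f ^ N) := by
    rw [RingHom.coe_pow]
    exact hf.iterate N
  obtain ⟨t, rfl⟩ := hs r
  have h1 : t ∈ g (N + 1) := by
    change (f ^ (N + 1)) t = 0
    rw [pow_succ', RingHom.mul_def, RingHom.comp_apply, hr]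
  rw [← hN (N + 1) (Nat.le_succ N)] at h1
  exact h1

/-- Membership is tested on monomials, and `X i` does not change the exponents of the variables in
`s`. -/
theorem mem_span_X_of_X_mul_mem {σ R : Type*} [CommRing R] {s : Set σ} {i : σ} (hi : i ∉ s)
    {p : MvPolynomial σ R}
    (hp : MvPolynomial.X i * p ∈ Ideal.span (MvPolynomial.X '' s : Set (MvPolynomial σ R))) :
    p ∈ Ideal.span (MvPolynomial.X '' s : Set (MvPolynomial σ R)) := by
  classical
  rw [MvPolynomial.mem_ideal_span_X_image] at hp ⊢
  intro d hd
  obtain ⟨j, hj, h⟩ := hp (Finsupp.single i 1 + d) (by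
    rw [MvPolynomial.support_X_mul]
    exact Finset.mem_map_of_mem _ hd)
  refine ⟨j, hj, ?_⟩
  have hij : i ≠ j := fun e => hi (e ▸ hj)
  simpa [Finsupp.single_apply, hij] using h

/-- A sequence of `p = dim V` vectors agrees with a basis up to its first vector that depends on the
preceding ones. -/
theorem exists_linearIndependent_agree {K V : Type*} [Field K] [AddCommGroup V] [Module K V]
    (l : ℕ → V) : ∀ k ≤ Module.finrank K V, ∃ z : Fin k → V, LinearIndependent K z ∧
      ((∀ j, z j = l j) ∨ ∃ i < k, (∀ j : Fin k, j.1 < i → z j = l j) ∧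
        l i ∈ Submodule.span K (l '' Set.Iio i))
  | 0, _ => ⟨Fin.elim0, linearIndependent_empty_type, Or.inl fun j => j.elim0⟩
  | k + 1, hk => by
    obtain ⟨z, hz, h⟩ := exists_linearIndependent_agree (K := K) l k (by omega)
    by_cases hl : (∀ j, z j = l j) ∧ l k ∉ Submodule.span K (Set.range z)
    · refine ⟨Fin.snoc z (l k), linearIndependent_finSnoc.mpr ⟨hz, hl.2⟩, Or.inl fun j => ?_⟩
      refine Fin.lastCases ?_ (fun j => ?_) j
      · simp
      · simpa using hl.1 j
    -- From the first dependency on, any independent continuation will do.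
    · obtain ⟨v, hv⟩ := exists_linearIndependent_snoc_of_lt_finrank hz (by omega)
      refine ⟨Fin.snoc z v, hv, Or.inr ?_⟩
      rcases h with h | ⟨i, hi, h1, h2⟩
      · have hlk : l k ∈ Submodule.span K (Set.range z) := by
          by_contra h'
          exact hl ⟨h, h'⟩
        refine ⟨k, by omega, fun j hj => ?_, ?_⟩
        · obtain ⟨j, rfl⟩ : ∃ j' : Fin k, j = j'.castSucc := ⟨⟨j, hj⟩, rfl⟩
          simpa using h j
        · refine Submodule.span_mono ?_ hlk
          rintro _ ⟨j, rfl⟩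
          exact ⟨j, j.2, (h j).symm⟩
      · refine ⟨i, by omega, fun j hj => ?_, h2⟩
        obtain ⟨j, rfl⟩ : ∃ j' : Fin k, j = j'.castSucc := ⟨⟨j, by omega⟩, rfl⟩
        simpa using h1 j hj

end LinearForms

/-! ### Bidegrees of monomials, uniformly for the two gradings -/

section Weights

variable {K : Type u} [Field K] {n m p q : ℕ} (w : Fin p ⊕ Fin q ≃ Fin n ⊕ Fin m)
  (pt : ℤ × ℤ ≃+ ℤ × ℤ)

/-- `w` and `pt` are both the identity for the `x`-degree and both the interchange for the
`y`-degree. -/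
theorem weight_varDeg (hw : ∀ i, varDeg n m (w i) = pt (varDeg p q i))
    (d : Fin n ⊕ Fin m →₀ ℕ) :
    Finsupp.weight (varDeg n m) d =
      pt (∑ i, (d (w (Sum.inl i)) : ℤ), ∑ j, (d (w (Sum.inr j)) : ℤ)) := by
  rw [Finsupp.weight_apply, Finsupp.sum_fintype _ _ (by simp), ← w.sum_comp]
  simp only [hw, ← map_nsmul, ← map_sum]
  congr 1
  rw [Fintype.sum_sum_type]
  ext <;> simp [varDeg, Prod.fst_sum, Prod.snd_sum]

theorem eq_zero_of_weight_varDeg_eq_zero {d : Fin n ⊕ Fin m →₀ ℕ}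
    (h : Finsupp.weight (varDeg n m) d = 0) : d = 0 := by
  rw [weight_varDeg (Equiv.refl _) (AddEquiv.refl _) (fun _ => rfl)] at h
  have h1 := congrArg Prod.fst h
  have h2 := congrArg Prod.snd h
  simp only [AddEquiv.refl_apply, Equiv.refl_apply, Prod.fst_zero, Prod.snd_zero] at h1 h2
  norm_cast at h1 h2
  rw [Finset.sum_eq_zero_iff] at h1 h2
  ext (i | j)
  exacts [h1 i (Finset.mem_univ _), h2 j (Finset.mem_univ _)]

theorem piece_eq_bot (hw : ∀ i, varDeg n m (w i) = pt (varDeg p q i)) {a b : ℤ} (hb : b < 0) :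
    piece K n m (pt (a, b)) = ⊥ := by
  rw [eq_bot_iff]
  intro f hf
  refine MvPolynomial.IsWeightedHomogeneous.eq_zero_of_no_monomials hf fun d hd => ?_
  rw [weight_varDeg w pt hw] at hd
  have h := congrArg Prod.snd (pt.injective hd)
  have h' : (0 : ℤ) ≤ ∑ j, (d (w (Sum.inr j)) : ℤ) := Finset.sum_nonneg fun _ _ => by positivity
  simp only at h
  omega

theorem exists_ne_zero_of_weight {d : Fin n ⊕ Fin m →₀ ℕ}
    (hw : ∀ i, varDeg n m (w i) = pt (varDeg p q i)) {a b : ℤ} (ha : a ≠ 0)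
    (hd : Finsupp.weight (varDeg n m) d = pt (a, b)) : ∃ i, d (w (Sum.inl i)) ≠ 0 := by
  by_contra! hc
  rw [weight_varDeg w pt hw] at hd
  have h := congrArg Prod.fst (pt.injective hd)
  simp only [hc, Nat.cast_zero, Finset.sum_const_zero] at h
  exact ha h.symm

theorem piece_le_span_X (hw : ∀ i, varDeg n m (w i) = pt (varDeg p q i)) {a b : ℤ} (ha : a ≠ 0)
    {f : PolyRing K n m} (hf : f ∈ piece K n m (pt (a, b))) :
    f ∈ Ideal.span (Set.range fun i => (MvPolynomial.X (w (Sum.inl i)) : PolyRing K n m)) := by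
  have e : (Set.range fun i => (MvPolynomial.X (w (Sum.inl i)) : PolyRing K n m)) =
      MvPolynomial.X '' Set.range (fun i => w (Sum.inl i)) := by
    rw [← Set.range_comp]
    rfl
  rw [e, MvPolynomial.mem_ideal_span_X_image]
  intro d hd
  obtain ⟨i, hi⟩ := exists_ne_zero_of_weight w pt hw ha (hf (MvPolynomial.mem_support_iff.mp hd))
  exact ⟨_, ⟨i, rfl⟩, hi⟩

theorem X_mem_piece (i : Fin n ⊕ Fin m) : MvPolynomial.X i ∈ piece K n m (varDeg n m i) :=
  MvPolynomial.isWeightedHomogeneous_X K _ i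

/-- A monomial of this degree contains a variable of the first group, and the cofactor has degree
`0`, so it is `1`. -/
theorem piece_one_eq_span (hw : ∀ i, varDeg n m (w i) = pt (varDeg p q i)) :
    piece K n m (pt (1, 0)) =
      Submodule.span K (Set.range fun i => (MvPolynomial.X (w (Sum.inl i)) : PolyRing K n m)) := by
  apply le_antisymm
  · intro f hf
    rw [MvPolynomial.as_sum f]
    refine sum_mem fun d hd => ?_
    have hd' := hf (MvPolynomial.mem_support_iff.mp hd)
    obtain ⟨i, hi⟩ := exists_ne_zero_of_weight w pt hw one_ne_zero hd'
    have hle : Finsupp.single (w (Sum.inl i)) 1 ≤ d := by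
      rw [Finsupp.single_le_iff]
      omega
    obtain ⟨d', hd'd⟩ := exists_add_of_le hle
    have h0 : Finsupp.weight (varDeg n m) d' = 0 := by
      rw [hd'd, map_add, Finsupp.weight_apply, Finsupp.sum_single_index (by simp), hw,
        one_smul] at hd'
      exact add_eq_left.mp hd'
    rw [eq_zero_of_weight_varDeg_eq_zero h0, add_zero] at hd'd
    have e : MvPolynomial.monomial d (MvPolynomial.coeff d f) =
        MvPolynomial.coeff d f • (MvPolynomial.X (w (Sum.inl i)) : PolyRing K n m) := by
      rw [hd'd, MvPolynomial.X, MvPolynomial.smul_monomial, smul_eq_mul, mul_one]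
    rw [e]
    exact Submodule.smul_mem _ _ (Submodule.subset_span ⟨i, rfl⟩)
  · rw [Submodule.span_le]
    rintro _ ⟨i, rfl⟩
    have := X_mem_piece (K := K) (w (Sum.inl i))
    rwa [hw] at this

theorem finrank_piece_one (hw : ∀ i, varDeg n m (w i) = pt (varDeg p q i)) :
    Module.finrank K (piece K n m (pt (1, 0))) = p := by
  rw [piece_one_eq_span w pt hw]
  have h : LinearIndependent K (fun i => (MvPolynomial.X (w (Sum.inl i)) : PolyRing K n m)) :=
    (MvPolynomial.linearIndependent_X (Fin n ⊕ Fin m) K).comp (fun i => w (Sum.inl i))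
      (w.injective.comp Sum.inl_injective)
  rw [finrank_span_eq_card h, Fintype.card_fin]

end Weights

/-! ### Vanishing conditions for the standard resolution in terms of ideals of `S` -/

section Standard

variable {K : Type u} [Field K] {n m : ℕ}

theorem single_mem_freePiece {c : ℤ × ℤ} {f : PolyRing K n m} (hf : f ∈ piece K n m c) :
    Finsupp.single PUnit.unit f ∈ freePiece (K := K) (fun _ : PUnit.{u + 1} => 0) c := by
  intro j
  cases j
  rwa [Finsupp.single_eq_same, sub_zero]

theorem apply_mem_piece {c : ℤ × ℤ} {u : PUnit.{u + 1} →₀ PolyRing K n m}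
    (hu : u ∈ freePiece (K := K) (fun _ : PUnit.{u + 1} => 0) c) :
    u PUnit.unit ∈ piece K n m c := by
  have := hu PUnit.unit
  rwa [sub_zero] at this

/-- Each homogeneous element of `Z` has its own basis vector in the cover, of the same degree. -/
theorem exists_cover_eq {ι : Type u} {deg : ι → ℤ × ℤ}
    {Z : Submodule (PolyRing K n m) (ι →₀ PolyRing K n m)} {c : ℤ × ℤ} {v : ι →₀ PolyRing K n m}
    (hv : v ∈ Z) (hvc : v ∈ freePiece (K := K) deg c) :
    ∃ w ∈ freePiece (K := K) (fun z : HomogElem deg Z => z.1) c, cover deg Z w = v := by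
  classical
  refine ⟨Finsupp.single ⟨c, v, hv, hvc⟩ 1, fun j => ?_, ?_⟩
  · rw [Finsupp.single_apply]
    split_ifs with h
    · subst h
      rw [sub_self]
      exact SetLike.one_mem_graded (piece K n m)
    · exact zero_mem _
  · rw [cover, Finsupp.linearCombination_single, one_smul]

theorem mem_ker_proj_iff (J : HomogeneousIdeal (piece K n m))
    {u : PUnit.{u + 1} →₀ PolyRing K n m} :
    u ∈ LinearMap.ker (proj J) ↔ u PUnit.unit ∈ J.toIdeal :=
  Submodule.Quotient.mk_eq_zero _

/-- The map `F_1 → F_0 = S` has image `J`, and homogeneity of `I` and `J` lets a decomposition in `I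
+ J` be taken within degree `c`. -/
theorem exists_cover_zero_iff {J : HomogeneousIdeal (piece K n m)} {I : Ideal (PolyRing K n m)}
    (hI : I.IsHomogeneous (piece K n m)) {c : ℤ × ℤ} {u : PUnit.{u + 1} →₀ PolyRing K n m}
    (hu : u PUnit.unit ∈ piece K n m c) :
    (∃ w ∈ freePiece (K := K)
        (fun z : HomogElem (fun _ : PUnit.{u + 1} => 0) (LinearMap.ker (proj J)) => z.1) c,
      u - cover (fun _ => 0) (LinearMap.ker (proj J)) w ∈
        I • (⊤ : Submodule (PolyRing K n m) (PUnit.{u + 1} →₀ PolyRing K n m))) ↔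
      u PUnit.unit ∈ I ⊔ J.toIdeal := by
  classical
  constructor
  · rintro ⟨w, -, h⟩
    rw [mem_smul_top_iff_forall] at h
    have h1 := h PUnit.unit
    have h2 := (mem_ker_proj_iff J).mp ((exact_proj J).apply_apply_eq_zero w)
    have := Submodule.add_mem_sup h1 h2
    rwa [Finsupp.sub_apply, sub_add_cancel] at this
  · intro h
    obtain ⟨r, hr, s, hs, hrs⟩ := Submodule.mem_sup.mp h
    have h1 : ((DirectSum.decompose (piece K n m) r c : piece K n m c) : PolyRing K n m) +
        ((DirectSum.decompose (piece K n m) s c : piece K n m c) : PolyRing K n m) =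
          u PUnit.unit := by
      rw [← Submodule.coe_add, ← DirectSum.add_apply, ← DirectSum.decompose_add, hrs]
      exact DirectSum.decompose_of_mem_same _ hu
    obtain ⟨w, hw, hw'⟩ := exists_cover_eq (Z := LinearMap.ker (proj J))
      ((mem_ker_proj_iff J).mpr (by
        rw [Finsupp.single_eq_same]
        exact J.isHomogeneous c hs))
      (single_mem_freePiece (SetLike.coe_mem (DirectSum.decompose (piece K n m) s c)))
    refine ⟨w, hw, ?_⟩
    rw [hw', mem_smul_top_iff_forall]
    intro j
    cases j
    rw [Finsupp.sub_apply, Finsupp.single_eq_same, ← h1, add_sub_cancel_right]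
    exact hI c hr

variable {J : HomogeneousIdeal (piece K n m)}

theorem colonVanishes_iff {I : Ideal (PolyRing K n m)} (hI : I.IsHomogeneous (piece K n m))
    {z : PolyRing K n m} {e c : ℤ × ℤ} (hz : z ∈ piece K n m e) :
    (standardResolution J).ColonVanishes I z e c ↔
      ∀ f ∈ piece K n m c, z * f ∈ I ⊔ J.toIdeal → f ∈ I ⊔ J.toIdeal := by
  have hzf {f : PolyRing K n m} (hf : f ∈ piece K n m c) : z * f ∈ piece K n m (c + e) := by
    rw [add_comm]
    exact SetLike.mul_mem_graded hz hf
  constructor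
  · intro h f hf hzfI
    have e1 : (Finsupp.single PUnit.unit f : PUnit.{u + 1} →₀ PolyRing K n m) PUnit.unit = f :=
      Finsupp.single_eq_same
    rw [← e1] at hf hzfI ⊢
    exact (exists_cover_zero_iff hI hf).mp (h _ (single_mem_freePiece (by rwa [e1] at hf))
      ((exists_cover_zero_iff (u := z • Finsupp.single PUnit.unit f) hI (hzf hf)).mpr hzfI))
  · intro h u hu hzu
    have hu' := apply_mem_piece hu
    exact (exists_cover_zero_iff hI hu').mpr
      (h _ hu' ((exists_cover_zero_iff (u := z • (show PUnit.{u + 1} →₀ PolyRing K n m from u))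
        hI (hzf hu')).mp hzu))

theorem torVanishes_zero_iff {I : Ideal (PolyRing K n m)} (hI : I.IsHomogeneous (piece K n m))
    {c : ℤ × ℤ} : (standardResolution J).TorVanishes I 0 c ↔
      ∀ f ∈ piece K n m c, f ∈ I ⊔ J.toIdeal := by
  constructor
  · intro h f hf
    have e1 : (Finsupp.single PUnit.unit f : PUnit.{u + 1} →₀ PolyRing K n m) PUnit.unit = f :=
      Finsupp.single_eq_same
    rw [← e1] at hf ⊢
    exact (exists_cover_zero_iff hI hf).mp (h _ (single_mem_freePiece (by rwa [e1] at hf)))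
  · intro h u hu
    have hu' := apply_mem_piece hu
    exact (exists_cover_zero_iff hI hu').mpr (h _ hu')

theorem torVanishes_bot_succ (i : ℕ) (c : ℤ × ℤ) :
    (standardResolution J).TorVanishes ⊥ (i + 1) c := by
  intro v hv hdv
  rw [Submodule.bot_smul, Submodule.mem_bot] at hdv
  obtain ⟨w, hw, hwv⟩ := exists_cover_eq (deg := (stage J (i + 1)).deg)
    (Z := (stage J (i + 1)).Z) (c := c) hdv hv
  refine ⟨w, hw, ?_⟩
  have : v - (standardResolution J).d (i + 1) w = 0 := sub_eq_zero.mpr hwv.symm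
  rw [this]
  exact zero_mem _

/-- The vanishing of `Tor_i(K, S ⧸ J)_c`, read off from homogeneous elements of the resolution. -/
theorem betti_eq_zero_iff (i : ℕ) (c : ℤ × ℤ) :
    betti J i c = 0 ↔ (standardResolution J).TorVanishes (irrelevant K n m) i c := by
  rw [betti, rank_zero_iff, Submodule.Quotient.subsingleton_iff,
    Submodule.submoduleOf_eq_top]
  cases i with
  | zero =>
    constructor
    · intro h v hv
      obtain ⟨_, ⟨w, hw, rfl⟩, hwv⟩ := h ⟨v, hv, rfl⟩
      refine ⟨w, hw, ?_⟩
      exact (Submodule.Quotient.eq _).mp hwv.symm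
    · rintro h _ ⟨v, hv, rfl⟩
      obtain ⟨w, hw, hvw⟩ := h v hv
      exact ⟨_, ⟨w, hw, rfl⟩, ((Submodule.Quotient.eq _).mpr hvw).symm⟩
  | succ i =>
    constructor
    · intro h v hv hdv
      obtain ⟨_, ⟨w, hw, rfl⟩, hwv⟩ := h ⟨⟨v, hv, rfl⟩, (Submodule.Quotient.mk_eq_zero _).mpr hdv⟩
      refine ⟨w, hw, ?_⟩
      exact (Submodule.Quotient.eq _).mp hwv.symm
    · rintro h _ ⟨⟨v, hv, rfl⟩, hdv⟩
      obtain ⟨w, hw, hvw⟩ := h v hv ((Submodule.Quotient.mk_eq_zero _).mp hdv)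
      exact ⟨_, ⟨w, hw, rfl⟩, ((Submodule.Quotient.eq _).mpr hvw).symm⟩

theorem isHomogeneous_irrelevant : (irrelevant K n m).IsHomogeneous (piece K n m) := by
  refine Ideal.homogeneous_span _ _ ?_
  rintro _ ⟨i, rfl⟩
  exact ⟨_, X_mem_piece i⟩

theorem one_notMem_irrelevant : (1 : PolyRing K n m) ∉ irrelevant K n m := by
  rw [irrelevant, ← Set.image_univ, MvPolynomial.mem_ideal_span_X_image]
  intro h
  obtain ⟨i, -, hi⟩ := h 0 (by simp)
  exact hi rfl

/-- The degree `0` component of an element of `J` is its constant term and lies in `J`; were it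
nonzero, it would be a unit. -/
theorem le_irrelevant (hJ : J.toIdeal ≠ ⊤) : J.toIdeal ≤ irrelevant K n m := by
  intro f hf
  rw [irrelevant, ← Set.image_univ, MvPolynomial.mem_ideal_span_X_image]
  intro d hd
  by_contra! hc
  obtain rfl : d = 0 := Finsupp.ext fun i => hc i trivial
  have h0 := J.isHomogeneous 0 hf
  have e : ((DirectSum.decompose (piece K n m) f 0 : piece K n m 0) : PolyRing K n m) =
      MvPolynomial.C (MvPolynomial.coeff 0 f) := by
    have e1 : ((DirectSum.decompose (piece K n m) f 0 : piece K n m 0) : PolyRing K n m) =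
        MvPolynomial.weightedHomogeneousComponent (varDeg n m) 0 f :=
      MvPolynomial.weightedDecomposition.decompose'_apply K (varDeg n m) f 0
    rw [e1]
    ext d
    rw [MvPolynomial.coeff_weightedHomogeneousComponent, MvPolynomial.coeff_C]
    by_cases hd0 : d = 0
    · simp [hd0]
    · rw [if_neg fun h => hd0 (eq_zero_of_weight_varDeg_eq_zero h), if_neg (Ne.symm hd0)]
  rw [e] at h0
  exact hJ (Ideal.eq_top_of_isUnit_mem _ h0
    ((isUnit_iff_ne_zero.mpr (MvPolynomial.mem_support_iff.mp hd)).map MvPolynomial.C))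

theorem betti_zero_ne_zero (hJ : J.toIdeal ≠ ⊤) : betti J 0 0 ≠ 0 := by
  rw [Ne, betti_eq_zero_iff, torVanishes_zero_iff isHomogeneous_irrelevant,
    sup_eq_left.mpr (le_irrelevant hJ)]
  exact fun h => one_notMem_irrelevant (h 1 (SetLike.one_mem_graded (piece K n m)))

end Standard

/-! ### The regular sequence generating `𝔪`, and the theorem for a basis of forms -/

section Sequence

variable {K : Type u} [Field K] {n m p q : ℕ}

/-- The ideal `(z_0, …, z_{k-1})`. -/
def seqIdeal (z : ℕ → PolyRing K n m) (k : ℕ) : Ideal (PolyRing K n m) :=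
  Ideal.span (z '' Set.Iio k)

theorem seqIdeal_zero (z : ℕ → PolyRing K n m) : seqIdeal z 0 = ⊥ := by
  simp [seqIdeal]

theorem seqIdeal_succ (z : ℕ → PolyRing K n m) (k : ℕ) :
    seqIdeal z (k + 1) = seqIdeal z k ⊔ Ideal.span {z k} := by
  have : Set.Iio (k + 1) = Set.Iio k ∪ {k} := by
    ext j
    simp only [Set.mem_Iio, Set.mem_union, Set.mem_singleton_iff]
    omega
  rw [seqIdeal, this, Set.image_union, Set.image_singleton, Ideal.span_union]
  rfl

theorem isHomogeneous_seqIdeal {z : ℕ → PolyRing K n m}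
    (hz : ∀ k, SetLike.IsHomogeneousElem (piece K n m) (z k)) (k : ℕ) :
    (seqIdeal z k).IsHomogeneous (piece K n m) := by
  refine Ideal.homogeneous_span _ _ ?_
  rintro _ ⟨j, -, rfl⟩
  exact hz j

/-- Adjoining a regular sequence of `p` forms of degree `(1, 0)`, followed by forms of degree
`(0, 1)`, gives long exact sequences of `Tor`; here the degrees are relabelled by `pt`. -/
theorem longExactData (J : HomogeneousIdeal (piece K n m)) (pt : ℤ × ℤ ≃+ ℤ × ℤ) {N : ℕ}
    {z : ℕ → PolyRing K n m} (hpN : p ≤ N) (hz₁ : ∀ k < p, z k ∈ piece K n m (pt (1, 0)))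
    (hz₂ : ∀ k, p ≤ k → z k ∈ piece K n m (pt (0, 1)))
    (hreg : ∀ k < N, ∀ r, z k * r ∈ seqIdeal z k → r ∈ seqIdeal z k)
    (hneg : ∀ a b, b < 0 → piece K n m (pt (a, b)) = ⊥)
    (hpos : ∀ a b, 0 < a → ∀ f ∈ piece K n m (pt (a, b)), f ∈ seqIdeal z p) :
    LongExactData p N
      (fun k i a b => (standardResolution J).TorVanishes (seqIdeal z k) i (pt (a, b)))
      (fun k a b => (standardResolution J).ColonVanishes (seqIdeal z k) (z k) (pt (1, 0))
        (pt (a, b))) := by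
  have hI (k) : (seqIdeal z k).IsHomogeneous (piece K n m) := by
    refine isHomogeneous_seqIdeal (fun k => ?_) k
    by_cases hk : k < p
    exacts [⟨_, hz₁ k hk⟩, ⟨_, hz₂ k (by omega)⟩]
  have e₁ (a b : ℤ) : pt (a + 1, b) = pt (a, b) + pt (1, 0) := by
    rw [← map_add, Prod.mk_add_mk, add_zero]
  have e₂ (a b : ℤ) : pt (a, b + 1) = pt (a, b) + pt (0, 1) := by
    rw [← map_add, Prod.mk_add_mk, add_zero]
  constructor
  · exact hpN
  · intro i a b
    rw [seqIdeal_zero]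
    exact torVanishes_bot_succ i _
  · intro a b hb
    rw [torVanishes_zero_iff (hI 0), hneg a b hb]
    rintro f rfl
    exact zero_mem _
  · intro k _ a b h
    rw [seqIdeal_succ]
    exact h.zero_mono le_sup_left
  · intro a b ha
    rw [torVanishes_zero_iff (hI p)]
    exact fun f hf => Ideal.mem_sup_left (hpos a b ha f hf)
  · exact fun k _ a b h => h.colonVanishes
  · intro k hk a b h hA
    rw [e₁] at h ⊢
    rw [seqIdeal_succ]
    exact h.sup_one (hI k) (hz₁ k hk) hA
  · intro k hk i a b h h'
    rw [e₁] at h ⊢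
    rw [seqIdeal_succ]
    exact h.sup_succ (hI k) (hz₁ k hk) (hreg k (by omega)) h'
  · intro k hk a b h
    rw [e₁, seqIdeal_succ] at h
    exact h.colonVanishes_of_sup (hI k) (hz₁ k hk) (hreg k (by omega))
  · intro k hk i a b h h'
    rw [e₁] at h h'
    rw [seqIdeal_succ] at h
    exact h.of_sup_succ (hI k) (hz₁ k hk) (hreg k (by omega)) h'
  · intro k hpk hk i a b h h'
    rw [e₂] at h ⊢
    rw [seqIdeal_succ]
    cases i with
    | zero => exact h.sup_one (hI k) (hz₂ k hpk) h'.colonVanishes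
    | succ i => exact h.sup_succ (hI k) (hz₂ k hpk) (hreg k hk) h'
  · intro k hpk hk i a b h h'
    rw [e₂] at h' ⊢
    rw [seqIdeal_succ] at h'
    exact h.of_sup (hI k) (hz₂ k hpk) (hreg k hk) h'

/-- The linear forms `ℓ_0, …, ℓ_{p-1}`, followed by the variables of the other group. -/
def extendSeq (w : Fin p ⊕ Fin q ≃ Fin n ⊕ Fin m) (ℓ : Fin p → PolyRing K n m) (k : ℕ) :
    PolyRing K n m :=
  if h : k < p + q then
    Sum.elim ℓ (fun j => MvPolynomial.X (w (Sum.inr j))) (finSumFinEquiv.symm ⟨k, h⟩)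
  else 0

variable (w : Fin p ⊕ Fin q ≃ Fin n ⊕ Fin m) (ℓ : Fin p → PolyRing K n m)

theorem extendSeq_left (i : Fin p) : extendSeq w ℓ i = ℓ i := by
  rw [extendSeq, dif_pos (by omega)]
  have : (⟨i, by omega⟩ : Fin (p + q)) = Fin.castAdd q i := rfl
  rw [this, finSumFinEquiv_symm_apply_castAdd, Sum.elim_inl]

theorem extendSeq_right (j : Fin q) :
    extendSeq w ℓ (p + j) = MvPolynomial.X (w (Sum.inr j)) := by
  rw [extendSeq, dif_pos (by omega)]
  have : (⟨p + j, by omega⟩ : Fin (p + q)) = Fin.natAdd p j := rfl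
  rw [this, finSumFinEquiv_symm_apply_natAdd, Sum.elim_inr]

theorem extendSeq_image_Iio (i : Fin p) :
    extendSeq w ℓ '' Set.Iio (i : ℕ) = ℓ '' Set.Iio i := by
  ext f
  constructor
  · rintro ⟨k, hk, rfl⟩
    have hk' : k < i := hk
    exact ⟨⟨k, by omega⟩, hk, (extendSeq_left w ℓ ⟨k, by omega⟩).symm⟩
  · rintro ⟨k, hk, rfl⟩
    exact ⟨k, hk, extendSeq_left w ℓ k⟩

section

variable (pt : ℤ × ℤ ≃+ ℤ × ℤ) (hw : ∀ i, varDeg n m (w i) = pt (varDeg p q i))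
  (hℓ : Submodule.span K (Set.range ℓ) = piece K n m (pt (1, 0)))
include hw hℓ

omit hw in
theorem extendSeq_mem_left {k : ℕ} (hk : k < p) : extendSeq w ℓ k ∈ piece K n m (pt (1, 0)) := by
  rw [← hℓ]
  exact Submodule.subset_span ⟨⟨k, hk⟩, (extendSeq_left w ℓ ⟨k, hk⟩).symm⟩

omit hℓ in
theorem extendSeq_mem_right {k : ℕ} (hk : p ≤ k) :
    extendSeq w ℓ k ∈ piece K n m (pt (0, 1)) := by
  by_cases hk' : k < p + q
  · obtain ⟨j, rfl⟩ : ∃ j : Fin q, k = p + j := ⟨⟨k - p, by omega⟩, by simp; omega⟩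
    rw [extendSeq_right]
    have := X_mem_piece (K := K) (w (Sum.inr j))
    rwa [hw] at this
  -- The default value `0` past the end belongs to every graded piece.
  · rw [extendSeq, dif_neg hk']
    exact zero_mem _

theorem X_mem_span (i : Fin p) :
    (MvPolynomial.X (w (Sum.inl i)) : PolyRing K n m) ∈ Submodule.span K (Set.range ℓ) := by
  rw [hℓ, piece_one_eq_span w pt hw]
  exact Submodule.subset_span ⟨i, rfl⟩

theorem X_mem_seqIdeal (i : Fin p) :
    (MvPolynomial.X (w (Sum.inl i)) : PolyRing K n m) ∈ seqIdeal (extendSeq w ℓ) p := by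
  have h : Submodule.span K (Set.range ℓ) ≤ (seqIdeal (extendSeq w ℓ) p).restrictScalars K := by
    rw [Submodule.span_le]
    rintro _ ⟨j, rfl⟩
    exact Ideal.subset_span ⟨j, j.2, extendSeq_left w ℓ j⟩
  exact h (X_mem_span w ℓ pt hw hℓ i)

theorem seqIdeal_extendSeq : seqIdeal (extendSeq w ℓ) (p + q) = irrelevant K n m := by
  apply le_antisymm
  · rw [seqIdeal, Ideal.span_le]
    rintro _ ⟨k, hk, rfl⟩
    by_cases hkp : k < p
    · have h : Submodule.span K (Set.range fun i =>
          (MvPolynomial.X (w (Sum.inl i)) : PolyRing K n m)) ≤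
          (irrelevant K n m).restrictScalars K := by
        rw [Submodule.span_le]
        rintro _ ⟨i, rfl⟩
        exact Ideal.subset_span ⟨_, rfl⟩
      refine h ?_
      rw [← piece_one_eq_span w pt hw]
      exact extendSeq_mem_left w ℓ pt hℓ hkp
    · have hk' : k < p + q := hk
      obtain ⟨j, rfl⟩ : ∃ j : Fin q, k = p + j := ⟨⟨k - p, by omega⟩, by simp; omega⟩
      rw [extendSeq_right]
      exact Ideal.subset_span ⟨_, rfl⟩
  · rw [irrelevant, Ideal.span_le]
    rintro _ ⟨i, rfl⟩
    obtain ⟨i | j, rfl⟩ := w.surjective i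
    · refine Ideal.span_mono (Set.image_mono fun k (hk : k < p) => ?_)
        (X_mem_seqIdeal w ℓ pt hw hℓ i)
      exact hk.trans_le (Nat.le_add_right p q)
    · exact Ideal.subset_span ⟨p + j, by simp, extendSeq_right w ℓ j⟩

/-- The substitution sending the variables to the sequence is surjective, as the forms span the
variables of the first group; being an endomorphism of a Noetherian ring, it is an automorphism and
transports regularity from the variables. -/
theorem extendSeq_regular {k : ℕ} (hk : k < p + q) {r : PolyRing K n m}
    (hr : extendSeq w ℓ k * r ∈ seqIdeal (extendSeq w ℓ) k) :
    r ∈ seqIdeal (extendSeq w ℓ) k := by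
  let o : Fin (p + q) ≃ Fin n ⊕ Fin m := finSumFinEquiv.symm.trans w
  let φ : PolyRing K n m →ₐ[K] PolyRing K n m :=
    MvPolynomial.aeval fun i => Sum.elim ℓ (fun j => MvPolynomial.X (w (Sum.inr j))) (w.symm i)
  have hφ (i : Fin (p + q)) : φ (MvPolynomial.X (o i)) = extendSeq w ℓ i := by
    rw [extendSeq, dif_pos i.2, MvPolynomial.aeval_X]
    simp [o]
  have hsurj : Function.Surjective φ := by
    rw [← AlgHom.range_eq_top, eq_top_iff, ← MvPolynomial.adjoin_range_X, Algebra.adjoin_le_iff]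
    rintro _ ⟨i, rfl⟩
    obtain ⟨i | j, rfl⟩ := w.surjective i
    · have h : Submodule.span K (Set.range ℓ) ≤ Subalgebra.toSubmodule φ.range := by
        rw [Submodule.span_le]
        rintro _ ⟨j, rfl⟩
        exact ⟨MvPolynomial.X (w (Sum.inl j)), by simp [φ]⟩
      exact h (X_mem_span w ℓ pt hw hℓ i)
    · exact ⟨MvPolynomial.X (w (Sum.inr j)), by simp [φ]⟩
  have hinj : Function.Injective φ := injective_of_surjective_ringHom φ.toRingHom hsurj
  let s : Set (Fin n ⊕ Fin m) := o '' {i | i.1 < k}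
  have hs : seqIdeal (extendSeq w ℓ) k =
      Ideal.map φ (Ideal.span (MvPolynomial.X '' s : Set (PolyRing K n m))) := by
    rw [Ideal.map_span, seqIdeal]
    congr 1
    ext f
    constructor
    · rintro ⟨j, hj, rfl⟩
      have hj' : j < k := hj
      exact ⟨_, ⟨_, ⟨⟨j, by omega⟩, hj', rfl⟩, rfl⟩, hφ ⟨j, by omega⟩⟩
    · rintro ⟨_, ⟨_, ⟨j, hj, rfl⟩, rfl⟩, rfl⟩
      exact ⟨j, hj, (hφ j).symm⟩
  have hmem (f : PolyRing K n m) : φ f ∈ seqIdeal (extendSeq w ℓ) k ↔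
      f ∈ Ideal.span (MvPolynomial.X '' s : Set (PolyRing K n m)) := by
    rw [hs, ← Ideal.mem_comap, Ideal.comap_map_of_bijective φ ⟨hinj, hsurj⟩]
  obtain ⟨r, rfl⟩ := hsurj r
  have hk' := hφ ⟨k, hk⟩
  simp only at hk'
  rw [← hk', ← map_mul, hmem] at hr
  rw [hmem]
  refine mem_span_X_of_X_mul_mem ?_ hr
  rintro ⟨j, hj, hjk⟩
  have := o.injective hjk
  rw [this] at hj
  exact lt_irrefl k hj

/-- The regularity of `S ⧸ J` with respect to the first degree, from a basis of linear forms. -/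
theorem betti_of_basis {J : HomogeneousIdeal (piece K n m)} (hJ : J.toIdeal ≠ ⊤) (s : ℕ)
    (hA : ∀ i a b, (s : ℤ) < a → ∀ f ∈ piece K n m (pt (a, b)),
      ℓ i * f ∈ Ideal.span (ℓ '' Set.Iio i) ⊔ J.toIdeal →
        f ∈ Ideal.span (ℓ '' Set.Iio i) ⊔ J.toIdeal)
    (hB : s = 0 ∨ ∃ i b, ∃ f ∈ piece K n m (pt (s, b)),
      ℓ i * f ∈ Ideal.span (ℓ '' Set.Iio i) ⊔ J.toIdeal ∧
        f ∉ Ideal.span (ℓ '' Set.Iio i) ⊔ J.toIdeal) :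
    (∀ (i : ℕ) (a b : ℤ), (s : ℤ) < a → betti J i (pt (a + i, b)) = 0) ∧
      ∃ (i : ℕ) (b : ℤ), betti J i (pt (s + i, b)) ≠ 0 := by
  have hL := longExactData J pt (N := p + q) (z := extendSeq w ℓ) (Nat.le_add_right p q)
    (fun k hk => extendSeq_mem_left w ℓ pt hℓ hk)
    (fun k hk => extendSeq_mem_right w ℓ pt hw hk)
    (fun k hk r => extendSeq_regular w ℓ pt hw hℓ hk)
    (fun a b hb => piece_eq_bot w pt hw hb)
    (fun a b ha f hf => by
      have h : Ideal.span (Set.range fun i => (MvPolynomial.X (w (Sum.inl i)) : PolyRing K n m)) ≤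
          seqIdeal (extendSeq w ℓ) p := by
        rw [Ideal.span_le]
        rintro _ ⟨i, rfl⟩
        exact X_mem_seqIdeal w ℓ pt hw hℓ i
      exact h (piece_le_span_X w pt hw ha.ne' hf))
  have hI (k) : (seqIdeal (extendSeq w ℓ) k).IsHomogeneous (piece K n m) := by
    refine isHomogeneous_seqIdeal (fun k => ?_) k
    by_cases hk : k < p
    exacts [⟨_, extendSeq_mem_left w ℓ pt hℓ hk⟩,
      ⟨_, extendSeq_mem_right w ℓ pt hw (by omega : p ≤ k)⟩]
  have hcol (i : Fin p) (c : ℤ × ℤ) : (standardResolution J).ColonVanishes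
      (seqIdeal (extendSeq w ℓ) i) (extendSeq w ℓ i) (pt (1, 0)) c ↔
      ∀ f ∈ piece K n m c, ℓ i * f ∈ Ideal.span (ℓ '' Set.Iio i) ⊔ J.toIdeal →
        f ∈ Ideal.span (ℓ '' Set.Iio i) ⊔ J.toIdeal := by
    rw [colonVanishes_iff (hI i) (extendSeq_mem_left w ℓ pt hℓ i.2), seqIdeal,
      extendSeq_image_Iio, extendSeq_left]
  have hA' : ∀ k < p, ∀ a b, (s : ℤ) < a → (standardResolution J).ColonVanishes
      (seqIdeal (extendSeq w ℓ) k) (extendSeq w ℓ k) (pt (1, 0)) (pt (a, b)) :=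
    fun k hk a b ha => (hcol ⟨k, hk⟩ _).mpr (hA ⟨k, hk⟩ a b ha)
  have hN := seqIdeal_extendSeq w ℓ pt hw hℓ
  constructor
  · intro i a b ha
    rw [betti_eq_zero_iff, ← hN]
    exact hL.vanishes_xy hA' _ (Nat.le_add_right p q) le_rfl i a b ha
  · rcases hB with rfl | ⟨i, b, f, hf, hf₁, hf₂⟩
    · refine ⟨0, 0, ?_⟩
      have e : pt (((0 : ℕ) : ℤ) + ((0 : ℕ) : ℤ), 0) = 0 := map_zero pt
      rw [e]
      exact betti_zero_ne_zero hJ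
    · obtain ⟨j, b', h⟩ := hL.exists_not_vanishes hA' i.2
        (b := b) (fun h => hf₂ ((hcol i _).mp h f hf hf₁))
      refine ⟨j, b', ?_⟩
      rwa [Ne, betti_eq_zero_iff, ← hN]

end

end Sequence

/-! ### Arbitrary forms, translation to the quotient ring, and the two suprema -/

section Regularity

variable {K : Type u} [Field K] {n m p q : ℕ}

/-- `betti_of_basis` without the assumption that the linear forms are a basis: they may be replaced
by a basis from the first form on that depends on the preceding ones. -/
theorem betti_of_forms (w : Fin p ⊕ Fin q ≃ Fin n ⊕ Fin m) (pt : ℤ × ℤ ≃+ ℤ × ℤ)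
    (hw : ∀ i, varDeg n m (w i) = pt (varDeg p q i))
    {J : HomogeneousIdeal (piece K n m)} (hJ : J.toIdeal ≠ ⊤) (l : Fin p → PolyRing K n m)
    (hl : ∀ i, l i ∈ piece K n m (pt (1, 0))) (s : ℕ)
    (hA : ∀ i a b, (s : ℤ) < a → ∀ f ∈ piece K n m (pt (a, b)),
      l i * f ∈ Ideal.span (l '' Set.Iio i) ⊔ J.toIdeal →
        f ∈ Ideal.span (l '' Set.Iio i) ⊔ J.toIdeal)
    (hB : s = 0 ∨ ∃ i b, ∃ f ∈ piece K n m (pt (s, b)),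
      l i * f ∈ Ideal.span (l '' Set.Iio i) ⊔ J.toIdeal ∧
        f ∉ Ideal.span (l '' Set.Iio i) ⊔ J.toIdeal) :
    (∀ (i : ℕ) (a b : ℤ), (s : ℤ) < a → betti J i (pt (a + i, b)) = 0) ∧
      ∃ (i : ℕ) (b : ℤ), betti J i (pt (s + i, b)) ≠ 0 := by
  have hfin : Module.finrank K (piece K n m (pt (1, 0))) = p := finrank_piece_one w pt hw
  let l' : ℕ → piece K n m (pt (1, 0)) := fun k => if h : k < p then ⟨l ⟨k, h⟩, hl _⟩ else 0
  have hl' (i : Fin p) : (l' i : PolyRing K n m) = l i := by simp [l']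
  obtain ⟨z, hz, h⟩ := exists_linearIndependent_agree (K := K) l' p hfin.ge
  have hspan : Submodule.span K (Set.range fun i => (z i : PolyRing K n m)) =
      piece K n m (pt (1, 0)) := by
    have : FiniteDimensional K (piece K n m (pt (1, 0))) := by
      rw [piece_one_eq_span w pt hw]
      exact FiniteDimensional.span_of_finite K (Set.finite_range _)
    have h1 : Submodule.span K (Set.range z) = ⊤ :=
      hz.span_eq_top_of_card_eq_finrank' (by rw [Fintype.card_fin, hfin])
    have h2 := congrArg (Submodule.map (piece K n m (pt (1, 0))).subtype) h1
    rw [Submodule.map_span, Submodule.map_subtype_top, ← Set.range_comp] at h2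
    exact h2
  rcases h with h | ⟨i₀, hi₀, h₁, h₂⟩
  · have e : (fun i => (z i : PolyRing K n m)) = l := funext fun i => by rw [h, hl']
    rw [e] at hspan
    exact betti_of_basis w l pt hw hspan hJ s hA hB
  · obtain ⟨i₀, rfl⟩ : ∃ i : Fin p, i₀ = i := ⟨⟨i₀, hi₀⟩, rfl⟩
    have hzl (j : Fin p) (hj : j < i₀) : (z j : PolyRing K n m) = l j := by rw [h₁ j hj, hl']
    have himg (j : Fin p) (hj : j ≤ i₀) :
        (fun i => (z i : PolyRing K n m)) '' Set.Iio j = l '' Set.Iio j :=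
      Set.image_congr fun k hk => hzl k (lt_of_lt_of_le hk hj)
    -- Hence `l i₀` annihilates the whole quotient at stage `i₀`, and the bound on annihilators
    -- becomes a bound on that quotient.
    have hdep : l i₀ ∈ Ideal.span (l '' Set.Iio i₀) := by
      have h3 := Submodule.mem_map_of_mem (f := (piece K n m (pt (1, 0))).subtype) h₂
      rw [Submodule.map_span, Submodule.subtype_apply, hl'] at h3
      have h4 : Submodule.span K ((piece K n m (pt (1, 0))).subtype '' (l' '' Set.Iio i₀.1)) ≤
          (Ideal.span (l '' Set.Iio i₀)).restrictScalars K := by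
        rw [Submodule.span_le]
        rintro _ ⟨_, ⟨j, hj, rfl⟩, rfl⟩
        have hj' : j < i₀ := hj
        exact Ideal.subset_span ⟨⟨j, by omega⟩, hj, (hl' ⟨j, by omega⟩).symm⟩
      exact h4 h3
    -- `S ⧸ (J + (l_j : j < i₀))` vanishes in degrees beyond `s`.
    have htop (a b : ℤ) (ha : (s : ℤ) < a) (f) (hf : f ∈ piece K n m (pt (a, b))) :
        f ∈ Ideal.span (l '' Set.Iio i₀) ⊔ J.toIdeal :=
      hA i₀ a b ha f hf (Ideal.mem_sup_left (Ideal.mul_mem_right _ _ hdep))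
    refine betti_of_basis w _ pt hw hspan hJ s ?_ ?_
    · intro i a b ha f hf hif
      by_cases hi : i < i₀
      · rw [himg i hi.le] at hif ⊢
        rw [hzl i hi] at hif
        exact hA i a b ha f hf hif
      · have hle : Ideal.span (l '' Set.Iio i₀) ≤
            Ideal.span ((fun i => (z i : PolyRing K n m)) '' Set.Iio i) := by
          rw [← himg i₀ le_rfl]
          exact Ideal.span_mono (Set.image_mono (Set.Iio_subset_Iio (not_lt.mp hi)))
        exact sup_le_sup_right hle _ (htop a b ha f hf)
    · refine hB.imp_right ?_
      rintro ⟨i, b, f, hf, hf₁, hf₂⟩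
      by_cases hi : i < i₀
      · refine ⟨i, b, f, hf, ?_⟩
        rw [himg i hi.le, hzl i hi]
        exact ⟨hf₁, hf₂⟩
      -- A witness at a stage from `i₀` on is already nonzero at stage `i₀`, and `z i₀` kills it
      -- there because the product has degree `s + 1`, where the quotient vanishes.
      · refine ⟨i₀, b, f, hf, ?_⟩
        rw [himg i₀ le_rfl]
        constructor
        · refine htop (s + 1) b (by omega) _ ?_
          have := SetLike.mul_mem_graded (z i₀).2 hf
          rwa [← map_add, Prod.mk_add_mk, zero_add, add_comm 1] at this
        · have hle : Ideal.span (l '' Set.Iio i₀) ≤ Ideal.span (l '' Set.Iio i) :=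
            Ideal.span_mono (Set.image_mono (Set.Iio_subset_Iio (not_lt.mp hi)))
          exact fun h => hf₂ (sup_le_sup_right hle _ h)

/-- The iterated quotient of `S` is the quotient by the sum of the two ideals. -/
theorem annPiece_eq_bot_iff (J : Ideal (PolyRing K n m)) {t : ℕ} (l : Fin t → PolyRing K n m)
    (i : Fin t) (c : ℤ × ℤ) :
    annPiece (quotGrading (quotGrading (piece K n m) J)
        (prevIdeal (fun i => Ideal.Quotient.mk J (l i)) i))
      (Ideal.Quotient.mk (prevIdeal (fun i => Ideal.Quotient.mk J (l i)) i)
        (Ideal.Quotient.mk J (l i))) c = ⊥ ↔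
      ∀ f ∈ piece K n m c, l i * f ∈ Ideal.span (l '' Set.Iio i) ⊔ J →
        f ∈ Ideal.span (l '' Set.Iio i) ⊔ J := by
  have h0 (f : PolyRing K n m) :
      Ideal.Quotient.mk (prevIdeal (fun i => Ideal.Quotient.mk J (l i)) i)
        (Ideal.Quotient.mk J f) = 0 ↔ f ∈ Ideal.span (l '' Set.Iio i) ⊔ J := by
    have e : prevIdeal (fun i => Ideal.Quotient.mk J (l i)) i =
        Ideal.map (Ideal.Quotient.mk J) (Ideal.span (l '' Set.Iio i)) := by
      rw [Ideal.map_span, ← Set.image_comp]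
      rfl
    rw [Ideal.Quotient.eq_zero_iff_mem, e, Ideal.mem_quotient_iff_mem_sup]
  rw [eq_bot_iff]
  constructor
  · intro h f hf hif
    refine (h0 f).mp ((Submodule.mem_bot K).mp (h ⟨⟨_, ⟨f, hf, rfl⟩, rfl⟩, ?_⟩))
    rw [← h0, map_mul, map_mul] at hif
    exact hif
  · rintro h _ ⟨⟨_, ⟨f, hf, rfl⟩, rfl⟩, hif⟩
    refine (h0 f).mpr (h f hf ((h0 _).mp ?_))
    rw [map_mul, map_mul]
    exact hif

/-- Almost regularity bounds the sets, so each `sSup` is an attained maximum and not the default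
value for unbounded sets. -/
theorem sup_sSup_spec {t : ℕ} {P : Fin t → ℤ → Prop}
    (hP : ∀ i, ∃ a₀ : ℤ, ∀ a ≥ a₀, ¬ P i a) :
    (∀ i a, ((Finset.univ.sup fun i => sSup ({a : ℕ | P i a} ∪ {0}) : ℕ) : ℤ) < a → ¬ P i a) ∧
      ((Finset.univ.sup fun i => sSup ({a : ℕ | P i a} ∪ {0})) = 0 ∨
        ∃ i, P i (Finset.univ.sup fun i => sSup ({a : ℕ | P i a} ∪ {0}) : ℕ)) := by
  have hbdd (i) : BddAbove ({a : ℕ | P i a} ∪ {0}) := by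
    obtain ⟨a₀, h⟩ := hP i
    refine ⟨a₀.toNat, ?_⟩
    rintro a (ha | rfl)
    · by_contra hc
      exact h a (by omega) ha
    · exact Nat.zero_le _
  constructor
  · intro i a ha hPa
    obtain ⟨a, rfl⟩ := Int.eq_ofNat_of_zero_le (by omega : 0 ≤ a)
    have h1 : a ≤ sSup ({a : ℕ | P i a} ∪ {0}) := le_csSup (hbdd i) (Or.inl hPa)
    have h2 := Finset.le_sup (f := fun i => sSup ({a : ℕ | P i a} ∪ {0})) (Finset.mem_univ i)
    omega
  · rcases Finset.univ.eq_empty_or_nonempty (α := Fin t) with h | h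
    · left
      rw [h, Finset.sup_empty, bot_eq_zero]
    · obtain ⟨i, -, hi⟩ := Finset.exists_mem_eq_sup _ h fun i => sSup ({a : ℕ | P i a} ∪ {0})
      rw [hi]
      have := Nat.sSup_mem (s := {a : ℕ | P i a} ∪ {0}) ⟨0, Or.inr rfl⟩ (hbdd i)
      rcases this with h' | h'
      · exact Or.inr ⟨i, h'⟩
      · exact Or.inl h'

/-- The regularity statement for one of the two degrees, with the degrees relabelled by `pt`. -/
theorem betti_of_annPiece (w : Fin p ⊕ Fin q ≃ Fin n ⊕ Fin m) (pt : ℤ × ℤ ≃+ ℤ × ℤ)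
    (hw : ∀ i, varDeg n m (w i) = pt (varDeg p q i))
    {J : HomogeneousIdeal (piece K n m)} (hJ : J.toIdeal ≠ ⊤)
    (x : Fin p → PolyRing K n m ⧸ J.toIdeal)
    (hx : ∀ i, x i ∈ quotGrading (piece K n m) J.toIdeal (pt (1, 0))) (s : ℕ)
    (hA : ∀ i (a : ℤ), (s : ℤ) < a → ¬ (⨆ b, annPiece
      (quotGrading (quotGrading (piece K n m) J.toIdeal) (prevIdeal x i))
      (Ideal.Quotient.mk (prevIdeal x i) (x i)) (pt (a, b))) ≠ ⊥)
    (hB : s = 0 ∨ ∃ i, (⨆ b, annPiece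
      (quotGrading (quotGrading (piece K n m) J.toIdeal) (prevIdeal x i))
      (Ideal.Quotient.mk (prevIdeal x i) (x i)) (pt (s, b))) ≠ ⊥) :
    (∀ (i : ℕ) (a b : ℤ), (s : ℤ) < a → betti J i (pt (a + i, b)) = 0) ∧
      ∃ (i : ℕ) (b : ℤ), betti J i (pt (s + i, b)) ≠ 0 := by
  choose l hl hlx using hx
  obtain rfl : (fun i => Ideal.Quotient.mk J.toIdeal (l i)) = x := funext hlx
  simp only [Ne, iSup_eq_bot, annPiece_eq_bot_iff, not_not] at hA hB
  refine betti_of_forms w pt hw hJ l hl s (fun i a b ha => hA i a ha b) (hB.imp_right ?_)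
  rintro ⟨i, h⟩
  push Not at h
  exact ⟨i, h⟩

theorem sSup_eq_of_betti {β : ℕ → ℤ → ℤ → Prop} {s : ℕ}
    (h₁ : ∀ (i : ℕ) (a b : ℤ), (s : ℤ) < a → ¬ β i (a + i) b) (h₂ : ∃ i b, β i (s + i) b) :
    sSup {r : EReal | ∃ a : ℤ, r = ((a : ℝ) : EReal) ∧ ∃ (i : ℕ) (b : ℤ), β i (a + i) b} =
      ((s : ℕ) : EReal) := by
  refine IsGreatest.csSup_eq ⟨⟨s, by simp, h₂⟩, ?_⟩
  rintro _ ⟨a, rfl, i, b, h⟩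
  have ha : a ≤ s := by
    by_contra! hc
    exact h₁ i a b hc h
  have : (a : ℝ) ≤ (s : ℝ) := by exact_mod_cast ha
  exact_mod_cast this

end Regularity

end Bigraded
end

theorem theorem2p2 {K : Type u} [Field K] {n m : ℕ}
    (J : HomogeneousIdeal (Bigraded.piece K n m)) (hJ : J.toIdeal ≠ ⊤)
    (x : Fin n → Bigraded.PolyRing K n m ⧸ J.toIdeal)
    (hx : Bigraded.IsAlmostRegularX (Bigraded.quotGrading (Bigraded.piece K n m) J.toIdeal) x)
    (y : Fin m → Bigraded.PolyRing K n m ⧸ J.toIdeal)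
    (hy : Bigraded.IsAlmostRegularY (Bigraded.quotGrading (Bigraded.piece K n m) J.toIdeal) y) :
    Bigraded.regX J =
        ((Bigraded.sX (Bigraded.quotGrading (Bigraded.piece K n m) J.toIdeal) x : ℕ) : EReal) ∧
      Bigraded.regY J =
        ((Bigraded.sY (Bigraded.quotGrading (Bigraded.piece K n m) J.toIdeal) y : ℕ) : EReal) := by
  constructor
  · obtain ⟨hA, hB⟩ := Bigraded.sup_sSup_spec
      (P := fun i a => Bigraded.seqAnnX
        (Bigraded.quotGrading (Bigraded.piece K n m) J.toIdeal) x i a ≠ ⊥)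
      fun i => (hx.2 i).imp fun a₀ h a ha => not_not.mpr (h a ha)
    obtain ⟨h₁, h₂⟩ := Bigraded.betti_of_annPiece (Equiv.refl _) (AddEquiv.refl _)
      (fun _ => rfl) hJ x hx.1 _ hA hB
    exact Bigraded.sSup_eq_of_betti (β := fun i a b => Bigraded.betti J i (a, b) ≠ 0)
      (fun i a b ha => not_not.mpr (h₁ i a b ha)) h₂
  · obtain ⟨hA, hB⟩ := Bigraded.sup_sSup_spec
      (P := fun i b => Bigraded.seqAnnY
        (Bigraded.quotGrading (Bigraded.piece K n m) J.toIdeal) y i b ≠ ⊥)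
      fun i => (hy.2 i).imp fun a₀ h a ha => not_not.mpr (h a ha)
    -- Interchanging the groups of variables and the coordinates of the degree reduces `y` to `x`.
    obtain ⟨h₁, h₂⟩ := Bigraded.betti_of_annPiece (Equiv.sumComm _ _) AddEquiv.prodComm
      (by rintro (i | j) <;> rfl) hJ y hy.1 _ hA hB
    exact Bigraded.sSup_eq_of_betti (β := fun i b a => Bigraded.betti J i (a, b) ≠ 0)
      (fun i a b ha => not_not.mpr (h₁ i a b ha)) h₂
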